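/- Let $p$ be an odd prime, $n\ge 0$ an integer, and $\mathbb K$ an algebraically closed field of characteristic $p$ with a nontrivial valuation $v:\mathbb K^*\to\mathbb R$ with value group $\mathbb T=v(\mathbb K^*)$. A tropical polynomial $f=\bigoplus_{i=0}^n a_ix^i$ is identified with $(a_0,\dots,a_n)$. For $a_0,\dots,a_n\in\mathbb T$ we say that $0$ is a tropical double root of $f$ if there are $F=\sum_{i=0}^n A_iX^i\in\mathbb K[X]$ and $B\in\mathbb K^*$ with $v(A_i)=a_i$ for all $i$, $v(B)=0$ and $F(B)=F'(B)=0$. Let $H_{p,n}\subseteq\mathbb R^{n+1}$ be the closure of the set of all such $f$. A maximal cell of $H_{p,n}$ is the closure of a connected component of the set of those points of $H_{p,n}$ near which $H_{p,n}$ coincides with an affine subspace. Write $[i]$ for the residue class of $i$ modulo $p$; below, $i,j,k,l\in\{0,\dots,n\}$, and "the minimum is attained at" certain monomials means that it is attained at least at these. Theorem. The set of maximal cells of $H_{p,n}$ is exactly the following. * Type I: for $i,j,k$ with $[i],[j],[k]$ pairwise distinct, the cell $\{i,j,k\}$ of all $f\in\mathbb R^{n+1}$ whose minimal coefficient is attained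 at $i,j,k$. * Type II: for $i\ne j$ with $[i]=[j]$ and $k,l$ with $[k]\ne[l]$, $[k]\neq[i]$, $[l]\ne[i]$, the cell $[\{i,j\},\{k,l\}]$ of all $f$ whose minimal coefficient is attained at $i,j$ and such that, after deleting all monomials $r$ with $[r]=[i]$, the minimum is attained at $k,l$. * Type III: for $i\neq j$, $k\ne l$ with $[i]=[j]\ne[k]=[l]$, the cell $\{\{i,j\},\{k,l\}\}$ of all $f$ that satisfy the condition in Type II for the pairs $\{i,j\},\{k,l\}$ in this order or in the opposite order (minimum at $k,l$ and, after deleting the class $[k]$, minimum at $i,j$). These cells are the maximal cones of a rational polyhedral fan with support $H_{p,n}$ (they are finitely many rational polyhedral cones with union $H_{p,n}$, none contains another, and the intersection of any two is a face of both), and each of them has codimension $2$ in $\mathbb R^{n+1}$. No cell is counted twice: cells of different types are different, and two cells of the same type are equal if and only if their labels $\{i,j,k\}$, $[\{i,j\},\{k,l\}]$ (an ordered pair of unordered pairs) or $\{\{i,j\},\{k,l\}\}$ (an unordered pair of unordered pairs) are equal. Moreover, a tropical polynomial with coefficients $a_0,\dots,a_n\in\mathbb R$ lies in $H_{p,n}$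 with all $a_i\in\mathbb T$ if and only if all $a_i\in\mathbb T$ and $0$ is a tropical double root of it. -/

import Mathlib

open Polynomial Topology

/-- The tropical polynomial `⨁ a_i x^i` of degree `n` (all `n + 1` coefficients are real numbers) is
singular at the tropical point `b` with respect to `v`: it has a lift `F` of degree `n` with
`v (A_i) = a_i` for all `i`, having a multiple root `B` with `v B = b`. -/
def IsTropicalDoubleRoot {K : Type*} [Field K] (v : AddValuation K (WithTop ℝ)) {n : ℕ}
    (a : Fin (n + 1) → ℝ) (b : ℝ) : Prop :=
  ∃ F : K[X], F.natDegree = n ∧ (∀ i : Fin (n + 1), v (F.coeff i) = (a i : WithTop ℝ)) ∧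
    ∃ B : K, v B = (b : WithTop ℝ) ∧ F.eval B = 0 ∧ (derivative F).eval B = 0

/-- The tropical linear space `H_{p,n}` in `ℝ^(n+1)`: the closure of the set of the tropical
polynomials of degree `n` with `0` as a tropical double root (as always for a tropicalization, the
closure accounts for a value group smaller than `ℝ`). -/
def tropicalH {K : Type*} [Field K] (v : AddValuation K (WithTop ℝ)) (n : ℕ) :
    Set (Fin (n + 1) → ℝ) :=
  closure {a | IsTropicalDoubleRoot v a 0}

section Cells

variable {E : Type*} [AddCommGroup E] [Module ℝ E] [TopologicalSpace E]

/-- The points of `S` near which `S` is an affine subspace. -/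
def regularLocus (S : Set E) : Set E :=
  {x | x ∈ S ∧ ∃ L : AffineSubspace ℝ E, ∃ U ∈ 𝓝 x, S ∩ U = (L : Set E) ∩ U}

/-- A maximal cell of a polyhedral set `S` (for its coarsest polyhedral structure): the closure of a
connected component of the regular locus of `S`. -/
def IsMaximalCell (S C : Set E) : Prop :=
  ∃ x ∈ regularLocus S, C = closure (connectedComponentIn (regularLocus S) x)

end Cells

/-- A rational polyhedral cone: finitely many homogeneous linear inequalities with integer
coefficients. -/
def IsRationalCone {m : ℕ} (C : Set (Fin m → ℝ)) : Prop :=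
  ∃ s : Finset (Fin m → ℤ), C = {x | ∀ c ∈ s, 0 ≤ ∑ i, (c i : ℝ) * x i}

/-- `𝒞` is the set of maximal cones of a rational polyhedral fan with support `S`: the faces of the
members of `𝒞` form a fan. A face of a polyhedral cone is the same as a convex extreme subset, so
the condition `faces` says that the intersection of two members is a face of either of them. -/
structure IsFanOfMaximalCones {m : ℕ} (S : Set (Fin m → ℝ)) (𝒞 : Set (Set (Fin m → ℝ))) :
    Prop where
  finite : 𝒞.Finite
  cone : ∀ C ∈ 𝒞, IsRationalCone C
  faces : ∀ C ∈ 𝒞, ∀ D ∈ 𝒞, IsExtreme ℝ C (C ∩ D)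
  maximal : ∀ C ∈ 𝒞, ∀ D ∈ 𝒞, C ⊆ D → C = D
  support : ⋃₀ 𝒞 = S

/-- Two monomials `x^i` and `x^j` have the same residue class modulo `p`. -/
def SameClass (p : ℕ) {n : ℕ} (i j : Fin (n + 1)) : Prop := (i : ℕ) ≡ (j : ℕ) [MOD p]

/-- The labels `{i,j,k}` of type I. -/
def LabelI (p : ℕ) {n : ℕ} (i j k : Fin (n + 1)) : Prop :=
  ¬ SameClass p i j ∧ ¬ SameClass p i k ∧ ¬ SameClass p j k

/-- The labels `[{i,j},{k,l}]` of type II. -/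
def LabelII (p : ℕ) {n : ℕ} (i j k l : Fin (n + 1)) : Prop :=
  i ≠ j ∧ SameClass p i j ∧ ¬ SameClass p k i ∧ ¬ SameClass p l i ∧ ¬ SameClass p k l

/-- The labels `{{i,j},{k,l}}` of type III. -/
def LabelIII (p : ℕ) {n : ℕ} (i j k l : Fin (n + 1)) : Prop :=
  i ≠ j ∧ SameClass p i j ∧ ¬ SameClass p k i ∧ ¬ SameClass p l i ∧ k ≠ l ∧ SameClass p k l

/-- The minimum of the coefficients is attained (at least) at `i`, `j` and `k`. -/
def cellI {n : ℕ} (i j k : Fin (n + 1)) : Set (Fin (n + 1) → ℝ) :=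
  {a | IsMinOn a Set.univ i ∧ IsMinOn a Set.univ j ∧ IsMinOn a Set.univ k}

/-- The minimum of the coefficients is attained (at least) at `i` and `j`, and after deleting the
monomials in the class of `i` it is attained (at least) at `k` and `l`. -/
def cellII (p : ℕ) {n : ℕ} (i j k l : Fin (n + 1)) : Set (Fin (n + 1) → ℝ) :=
  {a | IsMinOn a Set.univ i ∧ IsMinOn a Set.univ j ∧
    IsMinOn a {r | ¬ SameClass p r i} k ∧ IsMinOn a {r | ¬ SameClass p r i} l}

/-- The cell `{{i,j},{k,l}}` of type III: the condition for `[{i,j},{k,l}]` holds for one of the two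
orders of the pairs `{i,j}` and `{k,l}`. -/
def cellIII (p : ℕ) {n : ℕ} (i j k l : Fin (n + 1)) : Set (Fin (n + 1) → ℝ) :=
  cellII p i j k l ∪ cellII p k l i j

def cellsI (p n : ℕ) : Set (Set (Fin (n + 1) → ℝ)) :=
  {C | ∃ i j k, LabelI p i j k ∧ C = cellI i j k}

def cellsII (p n : ℕ) : Set (Set (Fin (n + 1) → ℝ)) :=
  {C | ∃ i j k l, LabelII p i j k l ∧ C = cellII p i j k l}

def cellsIII (p n : ℕ) : Set (Set (Fin (n + 1) → ℝ)) :=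
  {C | ∃ i j k l, LabelIII p i j k l ∧ C = cellIII p i j k l}

/-! Replacing `A_r` by `A_r B^r` moves the root to `1`, so `0` is a tropical double root iff the
coefficients lift to a tuple with `∑ A_r = 0` and `∑ r A_r = 0`. For each class `c` the combination
`∑ (r - c) A_r = 0` loses exactly the monomials of class `c`, and its other weights lie in `𝔽_p^*`,
hence have valuation `0`. So the minimum of `a` outside every class is attained twice
(`HasDoubleMinima`).

This condition is also sufficient over the value group. By `hasDoubleMinima_iff` it places `a` in a
cell of type I, II or III, and there any lift can be corrected at the marked monomials, by solving
for some of them with one generic unit at a time (`PairMin.exists_lift`, `TripleMin.exists_lift`).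
The value group is divisible and nontrivial, hence dense, so `H_{p,n}` is the set of all real `a`
with double minima.

The rest is polyhedral. Each cell is a cone cut out by two coordinate equalities and inequalities `a
r ≤ a s`. A point where the inequalities are strict lies in no other cell
(`orderCone_eq_of_mem_strictOrderCone`). At any other point of a cell some ray stays in the cell
while its opposite leaves `H_{p,n}`, so the point is not regular
(`exists_ray_of_mem_cellRelations`). Hence the regular locus is the union of the strict cones, and
these give the maximal cells (`setOf_isMaximalCell_eq`). Cells meet in faces because inequalities
active inside a segment are active at its ends (`cellTransfer_of_mem_openSegment`). -/

/-! ### Cones of coordinate comparisons, and a criterion for maximal cells. -/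

section ConeGeometry

open Filter

variable {ι : Type*}

/-- The cone of all `a` with `a r = a s` whenever `E r s` and `a r ≤ a s` whenever `R r s`. -/
def orderCone (E R : ι → ι → Prop) : Set (ι → ℝ) :=
  {a | (∀ r s, E r s → a r = a s) ∧ ∀ r s, R r s → a r ≤ a s}

/-- The relatively open cone with `a r = a s` whenever `E r s` and `a r < a s` whenever `R r s`. -/
def strictOrderCone (E R : ι → ι → Prop) : Set (ι → ℝ) :=
  {a | (∀ r s, E r s → a r = a s) ∧ ∀ r s, R r s → a r < a s}

/-- The linear subspace of all `a` with `a r = a s` whenever `E r s`. -/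
def equalitySubspace (E : ι → ι → Prop) : Submodule ℝ (ι → ℝ) where
  carrier := {a | ∀ r s, E r s → a r = a s}
  add_mem' ha hb r s h := by simp [ha r s h, hb r s h]
  zero_mem' _ _ _ := rfl
  smul_mem' c a ha r s h := by simp [ha r s h]

variable {E R : ι → ι → Prop}

theorem mem_equalitySubspace {a : ι → ℝ} :
    a ∈ equalitySubspace E ↔ ∀ r s, E r s → a r = a s := Iff.rfl

theorem strictOrderCone_subset_orderCone : strictOrderCone E R ⊆ orderCone E R :=
  fun _ ha => ⟨ha.1, fun r s h => (ha.2 r s h).le⟩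

theorem isClosed_orderCone : IsClosed (orderCone E R) := by
  simp only [orderCone, Set.ofPred_and, Set.ofPred_forall]
  refine IsClosed.inter ?_ ?_
  · exact isClosed_iInter fun r => isClosed_iInter fun s => isClosed_iInter fun _ =>
      isClosed_eq (continuous_apply r) (continuous_apply s)
  · exact isClosed_iInter fun r => isClosed_iInter fun s => isClosed_iInter fun _ =>
      isClosed_le (continuous_apply r) (continuous_apply s)

theorem convex_strictOrderCone : Convex ℝ (strictOrderCone E R) := by
  intro x hx y hy a b ha hb hab
  refine ⟨fun r s h => by simp [hx.1 r s h, hy.1 r s h], fun r s h => ?_⟩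
  have h1 := hx.2 r s h
  have h2 := hy.2 r s h
  simp only [Pi.add_apply, Pi.smul_apply, smul_eq_mul]
  rcases ha.eq_or_lt with rfl | ha
  · have : b = 1 := by linarith
    subst this; linarith
  · nlinarith

theorem add_smul_mem_strictOrderCone {x y : ι → ℝ} (hx : x ∈ orderCone E R)
    (hy : y ∈ strictOrderCone E R) {t : ℝ} (ht : 0 < t) : x + t • y ∈ strictOrderCone E R := by
  refine ⟨fun r s h => by simp [hx.1 r s h, hy.1 r s h], fun r s h => ?_⟩
  have h1 := hx.2 r s h
  have h2 := hy.2 r s h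
  simp only [Pi.add_apply, Pi.smul_apply, smul_eq_mul]
  nlinarith

theorem tendsto_add_smul_nhdsGT (x y : ι → ℝ) :
    Tendsto (fun t : ℝ => x + t • y) (𝓝[>] 0) (𝓝 x) := by
  have h : Continuous fun t : ℝ => x + t • y := by fun_prop
  have := h.tendsto 0
  simp only [zero_smul, add_zero] at this
  exact this.mono_left nhdsWithin_le_nhds

theorem closure_eq_orderCone {T : Set (ι → ℝ)} (hne : (strictOrderCone E R).Nonempty)
    (h₁ : strictOrderCone E R ⊆ T) (h₂ : T ⊆ orderCone E R) : closure T = orderCone E R := by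
  refine (closure_minimal h₂ isClosed_orderCone).antisymm fun x hx => ?_
  obtain ⟨y, hy⟩ := hne
  refine mem_closure_of_tendsto (tendsto_add_smul_nhdsGT x y) ?_
  filter_upwards [self_mem_nhdsWithin] with t ht
  exact h₁ (add_smul_mem_strictOrderCone hx hy ht)

theorem exists_isOpen_strictOrderCone_eq [Finite ι] (E R : ι → ι → Prop) :
    ∃ U : Set (ι → ℝ), IsOpen U ∧ strictOrderCone E R = (equalitySubspace E : Set (ι → ℝ)) ∩ U := by
  refine ⟨⋂ r, ⋂ s, ⋂ _ : R r s, {a | a r < a s}, ?_, ?_⟩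
  · refine isOpen_iInter_of_finite fun r => isOpen_iInter_of_finite fun s =>
      isOpen_iInter_of_finite fun _ => isOpen_lt (continuous_apply r) (continuous_apply s)
  · ext a
    simp [strictOrderCone, mem_equalitySubspace]

/-- The strict cone is open in the equality subspace, so from a strict point a small step in any
direction of that subspace stays in the cone. -/
theorem vectorSpan_orderCone [Finite ι] (hne : (strictOrderCone E R).Nonempty) :
    vectorSpan ℝ (orderCone E R) = equalitySubspace E := by
  apply le_antisymm
  · rw [vectorSpan, Submodule.span_le]
    rintro _ ⟨x, hx, y, hy, rfl⟩ r s h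
    simp [hx.1 r s h, hy.1 r s h]
  · intro w hw
    obtain ⟨y, hy⟩ := hne
    obtain ⟨U, hU, hEU⟩ := exists_isOpen_strictOrderCone_eq E R
    have hyU : U ∈ 𝓝 y := hU.mem_nhds (hEU ▸ hy).2
    obtain ⟨t, htU, ht⟩ := (((tendsto_add_smul_nhdsGT y w).eventually hyU).and
      self_mem_nhdsWithin).exists
    have hmem : y + t • w ∈ strictOrderCone E R := by
      rw [hEU]
      exact ⟨(equalitySubspace E).add_mem hy.1 ((equalitySubspace E).smul_mem t hw), htU⟩
    have h := vsub_mem_vectorSpan ℝ (strictOrderCone_subset_orderCone hmem)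
      (strictOrderCone_subset_orderCone hy)
    rw [vsub_eq_sub, add_sub_cancel_left] at h
    exact (Submodule.smul_mem_iff _ (ne_of_gt ht)).1 h

theorem isRationalCone_orderCone {m : ℕ} (E R : Fin m → Fin m → Prop) :
    IsRationalCone (orderCone E R) := by
  classical
  refine ⟨((Finset.univ : Finset (Fin m × Fin m)).filter
    fun q => R q.1 q.2 ∨ E q.1 q.2 ∨ E q.2 q.1).image
      fun q => Pi.single q.2 1 - Pi.single q.1 1, ?_⟩
  have key : ∀ (x : Fin m → ℝ) (r s : Fin m),
      ∑ i, (((Pi.single s 1 - Pi.single r 1 : Fin m → ℤ) i : ℤ) : ℝ) * x i = x s - x r := by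
    intro x r s
    simp [Pi.single_apply, sub_mul, Finset.sum_sub_distrib]
  ext x
  simp only [orderCone, Set.mem_ofPred_eq, Finset.forall_mem_image, Finset.mem_filter,
    Finset.mem_univ, true_and, Prod.forall, key, sub_nonneg]
  constructor
  · rintro ⟨h1, h2⟩ r s (h | h | h)
    exacts [h2 r s h, (h1 r s h).le, (h1 s r h).ge]
  · intro h
    exact ⟨fun r s hE => le_antisymm (h r s (.inr (.inl hE))) (h s r (.inr (.inr hE))),
      fun r s hR => h r s (.inl hR)⟩

/-- The two equations are independent because `t₁` and `t₂` each occur in only one of them. The case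
`s₁ = s₂` is allowed, as type I needs it. -/
theorem finrank_equalitySubspace [Fintype ι] {s₁ t₁ s₂ t₂ : ι}
    (hE : ∀ r s, E r s ↔ (r = s₁ ∧ s = t₁) ∨ (r = s₂ ∧ s = t₂))
    (h₁₁ : s₁ ≠ t₁) (h₁₂ : s₁ ≠ t₂) (h₂₁ : s₂ ≠ t₁) (h₂₂ : s₂ ≠ t₂) (ht : t₁ ≠ t₂) :
    Module.finrank ℝ (equalitySubspace E) + 2 = Module.finrank ℝ (ι → ℝ) := by
  classical
  let f : (ι → ℝ) →ₗ[ℝ] ℝ × ℝ :=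
    LinearMap.prod
      (LinearMap.proj (R := ℝ) (φ := fun _ : ι => ℝ) t₁ - LinearMap.proj s₁)
      (LinearMap.proj (R := ℝ) (φ := fun _ : ι => ℝ) t₂ - LinearMap.proj s₂)
  have hker : LinearMap.ker f = equalitySubspace E := by
    ext a
    simp only [f, LinearMap.mem_ker, LinearMap.prod_apply, Function.prod_apply, Prod.mk_eq_zero,
      LinearMap.sub_apply, LinearMap.proj_apply, sub_eq_zero, mem_equalitySubspace, hE]
    constructor
    · rintro ⟨h1, h2⟩ r s (⟨rfl, rfl⟩ | ⟨rfl, rfl⟩)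
      exacts [h1.symm, h2.symm]
    · exact fun h => ⟨(h _ _ (.inl ⟨rfl, rfl⟩)).symm, (h _ _ (.inr ⟨rfl, rfl⟩)).symm⟩
  have hsurj : LinearMap.range f = ⊤ := by
    rw [LinearMap.range_eq_top]
    rintro ⟨x, y⟩
    refine ⟨Pi.single t₁ x + Pi.single t₂ y, ?_⟩
    simp [f, h₁₁, h₁₂, h₂₁, h₂₂, ht, ht.symm]
  have := f.finrank_range_add_finrank_ker
  rw [hker, hsurj, finrank_top] at this
  simp at this
  simp; omega

/-- A regular point of `S` cannot be left along a ray in `S` whose opposite ray is not in `S`. -/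
theorem eventually_sub_smul_mem_of_mem_regularLocus {S : Set (ι → ℝ)} {x d : ι → ℝ}
    (hx : x ∈ regularLocus S) (hd : ∀ t : ℝ, 0 < t → x + t • d ∈ S) :
    ∀ᶠ t : ℝ in 𝓝[>] 0, x - t • d ∈ S := by
  obtain ⟨hxS, L, U, hU, hSU⟩ := hx
  have hxL : x ∈ L := (hSU.subset ⟨hxS, mem_of_mem_nhds hU⟩).1
  have h1 := (tendsto_add_smul_nhdsGT x d).eventually hU
  have h2 := (tendsto_add_smul_nhdsGT x (-d)).eventually hU
  filter_upwards [h1, h2, self_mem_nhdsWithin] with t ht1 ht2 ht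
  have hL : x + t • d ∈ L := (hSU.subset ⟨hd t ht, ht1⟩).1
  have hL' : x - t • d ∈ L := by
    -- Parameter `-1` on the line through `x` and `x + t • d` is the reflected point `x - t • d`.
    have h := AffineMap.lineMap_mem (-1 : ℝ) hxL hL
    simpa [AffineMap.lineMap_apply, sub_eq_add_neg, add_comm] using h
  rw [smul_neg, ← sub_eq_add_neg] at ht2
  exact (hSU.superset ⟨hL', ht2⟩).1

/-- By `hsing` regular points are strict points, and by `huniq` only one cone is present near a
strict point. A component of the regular locus cannot mix this cone with the union of the others:
both are closed, and a common regular point would contradict `huniq`. So the component lies between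
the strict cone and its closure. -/
theorem setOf_isMaximalCell_eq [Finite ι] {S : Set (ι → ℝ)}
    {𝒟 : Set ((ι → ι → Prop) × (ι → ι → Prop))}
    (hS : ∀ x, x ∈ S ↔ ∃ d ∈ 𝒟, x ∈ orderCone d.1 d.2)
    (hne : ∀ d ∈ 𝒟, (strictOrderCone d.1 d.2).Nonempty)
    (huniq : ∀ d ∈ 𝒟, ∀ d' ∈ 𝒟, ∀ x ∈ strictOrderCone d.1 d.2, x ∈ orderCone d'.1 d'.2 →
      orderCone d.1 d.2 = orderCone d'.1 d'.2)
    (hsing : ∀ d ∈ 𝒟, ∀ x ∈ orderCone d.1 d.2, x ∉ strictOrderCone d.1 d.2 →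
      ∃ e : ι → ℝ, (∀ t : ℝ, 0 < t → x + t • e ∈ S) ∧ ∀ᶠ t : ℝ in 𝓝[>] 0, x - t • e ∉ S) :
    {C | IsMaximalCell S C} = {C | ∃ d ∈ 𝒟, C = orderCone d.1 d.2} := by
  have hreg : regularLocus S = {x | ∃ d ∈ 𝒟, x ∈ strictOrderCone d.1 d.2} := by
    ext x
    constructor
    · intro hx
      obtain ⟨d, hd, hxd⟩ := (hS x).1 hx.1
      refine ⟨d, hd, by_contra fun hxd' => ?_⟩
      obtain ⟨e, he1, he2⟩ := hsing d hd x hxd hxd'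
      obtain ⟨t, ht1, ht2⟩ := ((eventually_sub_smul_mem_of_mem_regularLocus hx he1).and he2).exists
      exact ht2 ht1
    · rintro ⟨d, hd, hxd⟩
      refine ⟨(hS x).2 ⟨d, hd, strictOrderCone_subset_orderCone hxd⟩, ?_⟩
      obtain ⟨U, hU, hEU⟩ := exists_isOpen_strictOrderCone_eq d.1 d.2
      -- Removing the finitely many cones that miss `x` leaves a neighbourhood of `x`.
      let V : Set (ι → ℝ) := (⋃ d' ∈ {d' ∈ 𝒟 | x ∉ orderCone d'.1 d'.2}, orderCone d'.1 d'.2)ᶜ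
      have hV : IsOpen V := by
        rw [isOpen_compl_iff]
        exact (Set.toFinite _).isClosed_biUnion fun d' _ => isClosed_orderCone
      have hxV : x ∈ V := by simp [V]
      refine ⟨(equalitySubspace d.1).toAffineSubspace, U ∩ V,
        (hU.inter hV).mem_nhds ⟨(hEU ▸ hxd).2, hxV⟩, ?_⟩
      ext y
      constructor
      · rintro ⟨hyS, hyU, hyV⟩
        refine ⟨?_, hyU, hyV⟩
        obtain ⟨d', hd', hyd'⟩ := (hS y).1 hyS
        have hxd' : x ∈ orderCone d'.1 d'.2 := by
          by_contra h
          exact hyV (Set.mem_biUnion (show d' ∈ {d' ∈ 𝒟 | x ∉ orderCone d'.1 d'.2} from ⟨hd', h⟩)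
            hyd')
        rw [← huniq d hd d' hd' x hxd hxd'] at hyd'
        exact hyd'.1
      · rintro ⟨hyL, hyU, hyV⟩
        have : y ∈ strictOrderCone d.1 d.2 := by rw [hEU]; exact ⟨hyL, hyU⟩
        exact ⟨(hS y).2 ⟨d, hd, strictOrderCone_subset_orderCone this⟩, hyU, hyV⟩
  have hcomp : ∀ d ∈ 𝒟, ∀ x ∈ strictOrderCone d.1 d.2,
      closure (connectedComponentIn (regularLocus S) x) = orderCone d.1 d.2 := by
    intro d hd x hx
    have hsub : strictOrderCone d.1 d.2 ⊆ regularLocus S := by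
      rw [hreg]; exact fun y hy => ⟨d, hd, hy⟩
    refine closure_eq_orderCone (hne d hd)
      (convex_strictOrderCone.isPreconnected.subset_connectedComponentIn hx hsub) ?_
    let C' : Set (ι → ℝ) := ⋃ d' ∈ {d' ∈ 𝒟 | orderCone d.1 d.2 ≠ orderCone d'.1 d'.2},
      orderCone d'.1 d'.2
    have hC' : IsClosed C' := (Set.toFinite _).isClosed_biUnion fun d' _ => isClosed_orderCone
    have hT : connectedComponentIn (regularLocus S) x ⊆ regularLocus S :=
      connectedComponentIn_subset _ _
    have hcover : connectedComponentIn (regularLocus S) x ⊆ orderCone d.1 d.2 ∪ C' := by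
      intro y hy
      obtain ⟨d', hd', hyd'⟩ := (hS y).1 (hT hy).1
      by_cases h : orderCone d.1 d.2 = orderCone d'.1 d'.2
      · exact .inl (h ▸ hyd')
      · exact .inr (Set.mem_biUnion
          (show d' ∈ {d' ∈ 𝒟 | orderCone d.1 d.2 ≠ orderCone d'.1 d'.2} from ⟨hd', h⟩) hyd')
    have hpre := isPreconnected_closed_iff.1
      (isPreconnected_connectedComponentIn (x := x) (F := regularLocus S)) _ _
      isClosed_orderCone hC' hcover
      ⟨x, mem_connectedComponentIn (hsub hx), strictOrderCone_subset_orderCone hx⟩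
    intro y hy
    refine (hcover hy).resolve_right fun hy' => ?_
    obtain ⟨z, hz, hzd, hz'⟩ := hpre ⟨y, hy, hy'⟩
    simp only [C', Set.mem_iUnion, Set.mem_ofPred_eq] at hz'
    obtain ⟨d', ⟨hd', hne'⟩, hzd'⟩ := hz'
    have := hT hz
    rw [hreg] at this
    obtain ⟨d'', hd'', hzd''⟩ := this
    exact hne' ((huniq d'' hd'' d hd z hzd'' hzd).symm.trans (huniq d'' hd'' d' hd' z hzd'' hzd'))
  ext C
  constructor
  · rintro ⟨x, hx, rfl⟩
    have hx' := hx
    rw [hreg] at hx'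
    obtain ⟨d, hd, hxd⟩ := hx'
    exact ⟨d, hd, hcomp d hd x hxd⟩
  · rintro ⟨d, hd, rfl⟩
    obtain ⟨x, hx⟩ := hne d hd
    exact ⟨x, by rw [hreg]; exact ⟨d, hd, hx⟩, (hcomp d hd x hx).symm⟩

/-- If `z` is in the open segment from `x` to `y`, all in the cone, then the inequalities that are
active at `z` are active at `x`. -/
theorem eq_of_mem_openSegment {x y z : ι → ℝ} (hx : x ∈ orderCone E R) (hy : y ∈ orderCone E R)
    (hz : z ∈ openSegment ℝ x y) {r s : ι} (hR : R r s) (hzrs : z r = z s) : x r = x s := by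
  obtain ⟨a, b, ha, hb, -, rfl⟩ := hz
  have h1 := hx.2 r s hR
  have h2 := hy.2 r s hR
  simp only [Pi.add_apply, Pi.smul_apply, smul_eq_mul] at hzrs
  have : a * (x s - x r) ≤ 0 := by nlinarith
  nlinarith

end ConeGeometry

/-! ### Double minima outside every class, and their three types. -/

section DoubleMinima

variable {ι γ : Type*}

/-- For every class `c`, the minimum of `a` outside of the class `c` is attained at least twice. -/
def HasDoubleMinima (cl : ι → γ) (a : ι → ℝ) : Prop :=
  ∀ c r, cl r ≠ c → ∃ s, s ≠ r ∧ cl s ≠ c ∧ a s ≤ a r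

/-- The minimum is attained at `i`, `j` and `k`. -/
def TripleMin (i j k : ι) (a : ι → ℝ) : Prop :=
  ∀ r, a i ≤ a r ∧ a j ≤ a r ∧ a k ≤ a r

/-- The minimum is attained at `i` and `j`, and outside of the class of `i` at `k` and `l`. -/
def PairMin (cl : ι → γ) (i j k l : ι) (a : ι → ℝ) : Prop :=
  (∀ r, a i ≤ a r ∧ a j ≤ a r) ∧ ∀ r, cl r ≠ cl i → a k ≤ a r ∧ a l ≤ a r

def ThreeClasses (cl : ι → γ) (i j k : ι) : Prop :=
  cl i ≠ cl j ∧ cl i ≠ cl k ∧ cl j ≠ cl k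

def PairAndTwo (cl : ι → γ) (i j k l : ι) : Prop :=
  i ≠ j ∧ cl i = cl j ∧ cl k ≠ cl i ∧ cl l ≠ cl i ∧ cl k ≠ cl l

def TwoPairs (cl : ι → γ) (i j k l : ι) : Prop :=
  i ≠ j ∧ cl i = cl j ∧ cl k ≠ cl i ∧ cl l ≠ cl i ∧ k ≠ l ∧ cl k = cl l

variable {cl : ι → γ} {a : ι → ℝ} {i j k l i' j' k' l' : ι}

theorem TripleMin.hasDoubleMinima (h : ThreeClasses cl i j k) (ha : TripleMin i j k a) :
    HasDoubleMinima cl a := by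
  unfold ThreeClasses at h
  intro c r hr
  have := ha r
  by_cases hi : i ≠ r ∧ cl i ≠ c
  · exact ⟨i, hi.1, hi.2, this.1⟩
  by_cases hj : j ≠ r ∧ cl j ≠ c
  · exact ⟨j, hj.1, hj.2, this.2.1⟩
  by_cases hk : k ≠ r ∧ cl k ≠ c
  · exact ⟨k, hk.1, hk.2, this.2.2⟩
  grind

theorem PairMin.hasDoubleMinima (hij : i ≠ j) (hcl : cl i = cl j) (hk : cl k ≠ cl i)
    (hl : cl l ≠ cl i) (hkl : k ≠ l) (ha : PairMin cl i j k l a) : HasDoubleMinima cl a := by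
  intro c r hr
  have h1 := ha.1 r
  have h2 := ha.2 r
  by_cases hc : c = cl i
  · subst hc
    by_cases h : k = r
    · exact ⟨l, by grind, hl, (h2 hr).2⟩
    · exact ⟨k, h, hk, (h2 hr).1⟩
  · by_cases h : i = r
    · exact ⟨j, by grind, by grind, h1.2⟩
    · exact ⟨i, h, Ne.symm hc, h1.1⟩

theorem HasDoubleMinima.exists_min [Finite ι] (h : HasDoubleMinima cl a) {c : γ}
    (hc : ∃ r, cl r ≠ c) :
    ∃ i j, i ≠ j ∧ cl i ≠ c ∧ cl j ≠ c ∧ ∀ r, cl r ≠ c → a i ≤ a r ∧ a j ≤ a r := by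
  obtain ⟨i, hi, hmin⟩ := Set.exists_min_image {r | cl r ≠ c} a (Set.toFinite _) hc
  obtain ⟨j, hji, hj, hle⟩ := h c i hi
  exact ⟨i, j, hji.symm, hi, hj, fun r hr => ⟨hmin r hr, hle.trans (hmin r hr)⟩⟩

/-- Two minimizers in one class are completed by the double minimum outside that class, giving type
II or III. Two minimizers `i`, `j` in different classes force a third one outside the class of `i`;
it either shares the class of `j`, which is the previous case, or gives type I. -/
theorem hasDoubleMinima_iff [Finite ι] [Nonempty ι] [Nontrivial γ]
    (hcl : ∀ i j, i ≠ j → ∃ r, cl r ≠ cl i) :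
    HasDoubleMinima cl a ↔ (∃ i j k, ThreeClasses cl i j k ∧ TripleMin i j k a) ∨
      (∃ i j k l, PairAndTwo cl i j k l ∧ PairMin cl i j k l a) ∨
      ∃ i j k l, TwoPairs cl i j k l ∧ PairMin cl i j k l a := by
  constructor
  · intro h
    obtain ⟨i, hi⟩ := Finite.exists_min a
    obtain ⟨c, hc⟩ := exists_ne (cl i)
    obtain ⟨j, hji, -, hj⟩ := h c i hc.symm
    have hj : ∀ r, a j ≤ a r := fun r => hj.trans (hi r)
    have pair : ∀ i j, i ≠ j → cl i = cl j → (∀ r, a i ≤ a r ∧ a j ≤ a r) →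
        (∃ r, cl r ≠ cl i) → (∃ i j k l, PairAndTwo cl i j k l ∧ PairMin cl i j k l a) ∨
          ∃ i j k l, TwoPairs cl i j k l ∧ PairMin cl i j k l a := by
      intro i j hij hcl hmin hex
      obtain ⟨k, l, hkl, hk, hl, hmin'⟩ := h.exists_min hex
      by_cases hc : cl k = cl l
      · exact .inr ⟨i, j, k, l, ⟨hij, hcl, hk, hl, hkl, hc⟩, hmin, hmin'⟩
      · exact .inl ⟨i, j, k, l, ⟨hij, hcl, hk, hl, hc⟩, hmin, hmin'⟩
    have hex := hcl i j hji.symm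
    by_cases hcl : cl i = cl j
    · exact .inr (pair i j hji.symm hcl (fun r => ⟨hi r, hj r⟩) hex)
    · obtain ⟨k, hkj, hk, hkle⟩ := h (cl i) j (Ne.symm hcl)
      have hk' : ∀ r, a k ≤ a r := fun r => hkle.trans (hj r)
      by_cases hck : cl k = cl j
      · exact .inr (pair j k hkj.symm hck.symm (fun r => ⟨hj r, hk' r⟩) ⟨i, hcl⟩)
      · exact .inl ⟨i, j, k, ⟨hcl, Ne.symm hk, Ne.symm hck⟩, fun r => ⟨hi r, hj r, hk' r⟩⟩
  · rintro (⟨i, j, k, h, ha⟩ | ⟨i, j, k, l, h, ha⟩ | ⟨i, j, k, l, h, ha⟩)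
    · exact ha.hasDoubleMinima h
    · exact ha.hasDoubleMinima h.1 h.2.1 h.2.2.1 h.2.2.2.1 (by rintro rfl; exact h.2.2.2.2 rfl)
    · exact ha.hasDoubleMinima h.1 h.2.1 h.2.2.1 h.2.2.2.1 h.2.2.2.2.1

end DoubleMinima

/-! ### The cells as order cones: strict points, boundary rays, faces. -/

section DoubleMinimaCones

variable {ι γ : Type*}

/-- The relation whose pairs are `(s₁, t₁)` and `(s₂, t₂)`. -/
def twoEqualities (s₁ t₁ s₂ t₂ r s : ι) : Prop := (r = s₁ ∧ s = t₁) ∨ (r = s₂ ∧ s = t₂)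

def tripleIneq (i j k r s : ι) : Prop := r = i ∧ s ≠ i ∧ s ≠ j ∧ s ≠ k

/-- Here `i` is compared with `k` and `l` too, so `a i = a k` is a boundary of a type II cell. -/
def pairAndTwoIneq (cl : ι → γ) (i j k l r s : ι) : Prop :=
  (r = i ∧ s ≠ i ∧ s ≠ j) ∨ (r = k ∧ cl s ≠ cl i ∧ s ≠ k ∧ s ≠ l)

/-- Each pair is compared only with monomials outside the class of the other pair, so `a i` and `a
k` are not compared. This makes the union of the two orders a single convex cone, with `a i = a k`
in its interior. -/
def twoPairsIneq (cl : ι → γ) (i j k l r s : ι) : Prop :=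
  (r = i ∧ cl s ≠ cl k ∧ s ≠ i ∧ s ≠ j) ∨ (r = k ∧ cl s ≠ cl i ∧ s ≠ k ∧ s ≠ l)

variable {cl : ι → γ} {a : ι → ℝ} {i j k l i' j' k' l' : ι}

theorem forall_twoEqualities {s₁ t₁ s₂ t₂ : ι} :
    (∀ r s, twoEqualities s₁ t₁ s₂ t₂ r s → a r = a s) ↔ a s₁ = a t₁ ∧ a s₂ = a t₂ := by
  unfold twoEqualities
  exact ⟨fun h => ⟨h _ _ (.inl ⟨rfl, rfl⟩), h _ _ (.inr ⟨rfl, rfl⟩)⟩, by grind⟩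

theorem mem_triple_strict :
    a ∈ strictOrderCone (twoEqualities i j i k) (tripleIneq i j k) ↔
      (a i = a j ∧ a i = a k) ∧ ∀ s, s ≠ i → s ≠ j → s ≠ k → a i < a s := by
  simp only [strictOrderCone, Set.mem_ofPred_eq, forall_twoEqualities, tripleIneq]
  grind

theorem mem_pairAndTwo_strict :
    a ∈ strictOrderCone (twoEqualities i j k l) (pairAndTwoIneq cl i j k l) ↔
      (a i = a j ∧ a k = a l) ∧ (∀ s, s ≠ i → s ≠ j → a i < a s) ∧
        ∀ s, cl s ≠ cl i → s ≠ k → s ≠ l → a k < a s := by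
  simp only [strictOrderCone, Set.mem_ofPred_eq, forall_twoEqualities, pairAndTwoIneq]
  grind

theorem mem_twoPairs_strict :
    a ∈ strictOrderCone (twoEqualities i j k l) (twoPairsIneq cl i j k l) ↔
      (a i = a j ∧ a k = a l) ∧ (∀ s, cl s ≠ cl k → s ≠ i → s ≠ j → a i < a s) ∧
        ∀ s, cl s ≠ cl i → s ≠ k → s ≠ l → a k < a s := by
  simp only [strictOrderCone, Set.mem_ofPred_eq, forall_twoEqualities, twoPairsIneq]
  grind

theorem mem_triple :
    a ∈ orderCone (twoEqualities i j i k) (tripleIneq i j k) ↔ TripleMin i j k a := by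
  simp only [orderCone, Set.mem_ofPred_eq, forall_twoEqualities, tripleIneq, TripleMin]
  constructor
  · rintro ⟨h1, h2⟩ r
    have := h2 i r
    grind
  · intro h
    have hi := h i
    have hj := h j
    have hk := h k
    exact ⟨by constructor <;> linarith, by grind⟩

theorem mem_pairAndTwo (h : PairAndTwo cl i j k l) :
    a ∈ orderCone (twoEqualities i j k l) (pairAndTwoIneq cl i j k l) ↔ PairMin cl i j k l a := by
  simp only [orderCone, Set.mem_ofPred_eq, forall_twoEqualities, pairAndTwoIneq, PairMin]
  unfold PairAndTwo at h
  constructor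
  · rintro ⟨h1, h2⟩
    refine ⟨fun r => ?_, fun r hr => ?_⟩
    · have := h2 i r
      grind
    · have := h2 k r
      grind
  · rintro ⟨h1, h2⟩
    have hi := h1 i
    have hj := h1 j
    have hk := h2 k
    have hl := h2 l
    exact ⟨by grind, by grind⟩

theorem mem_twoPairs (h : TwoPairs cl i j k l) :
    a ∈ orderCone (twoEqualities i j k l) (twoPairsIneq cl i j k l) ↔
      PairMin cl i j k l a ∨ PairMin cl k l i j a := by
  simp only [orderCone, Set.mem_ofPred_eq, forall_twoEqualities, twoPairsIneq, PairMin]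
  unfold TwoPairs at h
  constructor
  · rintro ⟨h1, h2⟩
    have hi := fun r => h2 i r
    have hk := fun r => h2 k r
    rcases le_total (a i) (a k) with hle | hle
    · refine .inl ⟨fun r => ?_, fun r hr => ?_⟩
      · have := hi r
        have := hk r
        grind
      · have := hk r
        grind
    · refine .inr ⟨fun r => ?_, fun r hr => ?_⟩
      · have := hi r
        have := hk r
        grind
      · have := hi r
        grind
  · rintro (⟨h1, h2⟩ | ⟨h1, h2⟩)
    · have hi := h1 i
      have hj := h1 j
      have hk := h2 k
      have hl := h2 l
      refine ⟨by grind, fun r s => ?_⟩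
      have := h1 s
      have := h2 s
      grind
    · have hi := h2 i
      have hj := h2 j
      have hk := h1 k
      have hl := h1 l
      refine ⟨by grind, fun r s => ?_⟩
      have := h1 s
      have := h2 s
      grind

theorem nonempty_triple :
    (strictOrderCone (twoEqualities i j i k) (tripleIneq i j k)).Nonempty := by
  classical
  refine ⟨fun r => if r = i ∨ r = j ∨ r = k then 0 else 1, mem_triple_strict.2 ?_⟩
  simp
  grind

theorem nonempty_pairAndTwo (h : PairAndTwo cl i j k l) :
    (strictOrderCone (twoEqualities i j k l) (pairAndTwoIneq cl i j k l)).Nonempty := by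
  classical
  refine ⟨fun r => if r = i ∨ r = j then 0 else if r = k ∨ r = l then 1 else 2,
    mem_pairAndTwo_strict.2 ?_⟩
  unfold PairAndTwo at h
  grind

theorem nonempty_twoPairs (h : TwoPairs cl i j k l) :
    (strictOrderCone (twoEqualities i j k l) (twoPairsIneq cl i j k l)).Nonempty := by
  classical
  refine ⟨fun r => if r = i ∨ r = j ∨ r = k ∨ r = l then 0 else 1, mem_twoPairs_strict.2 ?_⟩
  unfold TwoPairs at h
  grind

/-- At a strict point the minimizers are known exactly, so the label can be read off from the point.
This and the analogous results for the other types show that a strict point lies in no other cell.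
-/
theorem TripleMin.eq_of_mem_triple_strict [DecidableEq ι]
    (ha : a ∈ strictOrderCone (twoEqualities i j i k) (tripleIneq i j k))
    (h' : ThreeClasses cl i' j' k') (ha' : TripleMin i' j' k' a) :
    ({i, j, k} : Finset ι) = {i', j', k'} := by
  rw [mem_triple_strict] at ha
  have key : ∀ r, a r ≤ a i → r = i ∨ r = j ∨ r = k := by grind
  have h := ha' i
  have h1 := key i' h.1
  have h2 := key j' h.2.1
  have h3 := key k' h.2.2
  unfold ThreeClasses at h'
  ext x
  simp only [Finset.mem_insert, Finset.mem_singleton]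
  grind

theorem PairMin.false_of_mem_triple_strict (h : ThreeClasses cl i j k)
    (ha : a ∈ strictOrderCone (twoEqualities i j i k) (tripleIneq i j k))
    (hij : i' ≠ j') (hcl : cl i' = cl j') (ha' : PairMin cl i' j' k' l' a) : False := by
  rw [mem_triple_strict] at ha
  have key : ∀ r, a r ≤ a i → r = i ∨ r = j ∨ r = k := by grind
  unfold ThreeClasses at h
  have h0 := ha'.1 i
  have h1 := key i' h0.1
  have h2 := key j' h0.2
  grind

theorem TripleMin.false_of_mem_pairAndTwo_strict
    (ha : a ∈ strictOrderCone (twoEqualities i j k l) (pairAndTwoIneq cl i j k l))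
    (h' : ThreeClasses cl i' j' k') (ha' : TripleMin i' j' k' a) : False := by
  rw [mem_pairAndTwo_strict] at ha
  have key : ∀ r, a r ≤ a i → r = i ∨ r = j := by grind
  unfold ThreeClasses at h'
  have h := ha' i
  have h1 := key i' h.1
  have h2 := key j' h.2.1
  have h3 := key k' h.2.2
  grind

theorem PairMin.eq_of_mem_pairAndTwo_strict (h : PairAndTwo cl i j k l)
    (ha : a ∈ strictOrderCone (twoEqualities i j k l) (pairAndTwoIneq cl i j k l))
    (hij : i' ≠ j') (hk : cl k' ≠ cl i') (hl : cl l' ≠ cl i') (hkl : k' ≠ l')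
    (ha' : PairMin cl i' j' k' l' a) : s(i, j) = s(i', j') ∧ s(k, l) = s(k', l') := by
  rw [mem_pairAndTwo_strict] at ha
  unfold PairAndTwo at h
  have h0 := ha'.1 i
  have h1 := ha.2.1 i'
  have h2 := ha.2.1 j'
  have e : s(i, j) = s(i', j') := by rw [Sym2.eq_iff]; grind
  refine ⟨e, ?_⟩
  rw [Sym2.eq_iff] at e ⊢
  have h0 := ha'.2 k
  have h1 := ha.2.2 k'
  have h2 := ha.2.2 l'
  grind

theorem TripleMin.false_of_mem_twoPairs_strict (h : TwoPairs cl i j k l)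
    (ha : a ∈ strictOrderCone (twoEqualities i j k l) (twoPairsIneq cl i j k l))
    (h' : ThreeClasses cl i' j' k') (ha' : TripleMin i' j' k' a) : False := by
  rw [mem_twoPairs_strict] at ha
  unfold TwoPairs at h
  have key : ∀ r, (∀ s, a r ≤ a s) → r = i ∨ r = j ∨ r = k ∨ r = l := by
    intro r hr
    have h1 := hr i
    have h2 := hr k
    have h3 := ha.2.1 r
    have h4 := ha.2.2 r
    grind
  have h1 := key i' fun s => (ha' s).1
  have h2 := key j' fun s => (ha' s).2.1
  have h3 := key k' fun s => (ha' s).2.2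
  unfold ThreeClasses at h'
  grind

theorem PairMin.eq_of_mem_twoPairs_strict (h : TwoPairs cl i j k l)
    (ha : a ∈ strictOrderCone (twoEqualities i j k l) (twoPairsIneq cl i j k l))
    (hij : i' ≠ j') (hcl : cl i' = cl j') (hk : cl k' ≠ cl i') (hl : cl l' ≠ cl i')
    (hkl : k' ≠ l') (ha' : PairMin cl i' j' k' l' a) :
    s(s(i, j), s(k, l)) = s(s(i', j'), s(k', l')) := by
  rw [mem_twoPairs_strict] at ha
  unfold TwoPairs at h
  have key : ∀ r, (∀ s, a r ≤ a s) → r = i ∨ r = j ∨ r = k ∨ r = l := by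
    intro r hr
    have h1 := hr i
    have h2 := hr k
    have h3 := ha.2.1 r
    have h4 := ha.2.2 r
    grind
  have h1 := key i' fun s => (ha'.1 s).1
  have h2 := key j' fun s => (ha'.1 s).2
  -- All minimizers are among `i, j, k, l`, and `i'`, `j'` share a class, so they form one of the
  -- two pairs; the minima outside that class then give the other.
  have : (i = i' ∧ j = j' ∨ i = j' ∧ j = i') ∨ (k = i' ∧ l = j' ∨ k = j' ∧ l = i') := by grind
  simp only [Sym2.eq_iff]
  rcases this with h3 | h3
  · have h4 := ha'.2 k
    have h5 := ha.2.2 k'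
    have h6 := ha.2.2 l'
    left
    exact ⟨h3, by grind⟩
  · have h4 := ha'.2 i
    have h5 := ha.2.1 k'
    have h6 := ha.2.1 l'
    right
    exact ⟨by grind, h3⟩

theorem not_hasDoubleMinima_of_unique {c : γ} {r : ι} (hr : cl r ≠ c)
    (h : ∀ s, s ≠ r → cl s ≠ c → a r < a s) : ¬ HasDoubleMinima cl a := fun ha => by
  obtain ⟨s, hs, hsc, hle⟩ := ha c r hr
  exact (h s hs hsc).not_ge hle

/-- Lowering the coefficient of one of several minima outside of a class. -/
theorem not_hasDoubleMinima_sub_single [DecidableEq ι] {c : γ} {r : ι} (hr : cl r ≠ c)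
    (h : ∀ s, cl s ≠ c → a r ≤ a s) {t : ℝ} (ht : 0 < t) :
    ¬ HasDoubleMinima cl (a - t • Pi.single r 1) := by
  refine not_hasDoubleMinima_of_unique hr fun s hs hsc => ?_
  have := h s hsc
  simp [hs]
  linarith

theorem tripleMin_add_single [DecidableEq ι] {r : ι} (hi : r ≠ i) (hj : r ≠ j) (hk : r ≠ k)
    (ha : TripleMin i j k a) {t : ℝ} (ht : 0 < t) : TripleMin i j k (a + t • Pi.single r 1) := by
  intro s
  have := ha s
  by_cases h : s = r
  · subst h
    simp [hi.symm, hj.symm, hk.symm]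
    exact ⟨by linarith, by linarith, by linarith⟩
  · simpa [h, hi.symm, hj.symm, hk.symm] using this

theorem pairMin_add_single [DecidableEq ι] {r : ι} (hi : r ≠ i) (hj : r ≠ j) (hk : r ≠ k)
    (hl : r ≠ l) (ha : PairMin cl i j k l a) {t : ℝ} (ht : 0 < t) :
    PairMin cl i j k l (a + t • Pi.single r 1) := by
  have h : ∀ s, a s ≤ (a + t • (Pi.single r 1 : ι → ℝ)) s := by
    intro s
    by_cases h : s = r
    · subst h; simp [ht.le]
    · simp [h]
  have hi : (a + t • (Pi.single r 1 : ι → ℝ)) i = a i := by simp [hi.symm]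
  have hj : (a + t • (Pi.single r 1 : ι → ℝ)) j = a j := by simp [hj.symm]
  have hk : (a + t • (Pi.single r 1 : ι → ℝ)) k = a k := by simp [hk.symm]
  have hl : (a + t • (Pi.single r 1 : ι → ℝ)) l = a l := by simp [hl.symm]
  unfold PairMin
  rw [hi, hj, hk, hl]
  exact ⟨fun s => ⟨(ha.1 s).1.trans (h s), (ha.1 s).2.trans (h s)⟩,
    fun s hs => ⟨(ha.2 s hs).1.trans (h s), (ha.2 s hs).2.trans (h s)⟩⟩

/-- A boundary point of a cell can be left along a ray in that cell whose opposite is not in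
the set. -/
theorem exists_ray_triple [Nontrivial γ] (ha : TripleMin i j k a)
    (ha' : a ∉ strictOrderCone (twoEqualities i j i k) (tripleIneq i j k)) :
    ∃ e : ι → ℝ, (∀ t : ℝ, 0 < t → TripleMin i j k (a + t • e)) ∧
      ∀ t : ℝ, 0 < t → ¬ HasDoubleMinima cl (a - t • e) := by
  classical
  rw [mem_triple_strict] at ha'
  have hi := ha i
  have hj := ha j
  have hk := ha k
  -- An additional minimizer `r`: raising its coefficient stays in the cell, lowering it makes the
  -- minimum unique.
  obtain ⟨r, h1, h2, h3, h4⟩ : ∃ r, r ≠ i ∧ r ≠ j ∧ r ≠ k ∧ a r ≤ a i := by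
    by_contra! hcon
    exact ha' ⟨by constructor <;> linarith, hcon⟩
  obtain ⟨c, hc⟩ := exists_ne (cl r)
  exact ⟨Pi.single r 1, fun t ht => tripleMin_add_single h1 h2 h3 ha ht, fun t ht =>
    not_hasDoubleMinima_sub_single hc.symm (fun s _ => h4.trans (ha s).1) ht⟩

theorem exists_ray_pairAndTwo [Nontrivial γ] (h : PairAndTwo cl i j k l)
    (ha : PairMin cl i j k l a)
    (ha' : a ∉ strictOrderCone (twoEqualities i j k l) (pairAndTwoIneq cl i j k l)) :
    ∃ e : ι → ℝ, (∀ t : ℝ, 0 < t → PairMin cl i j k l (a + t • e)) ∧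
      ∀ t : ℝ, 0 < t → ¬ HasDoubleMinima cl (a - t • e) := by
  classical
  rw [mem_pairAndTwo_strict] at ha'
  unfold PairAndTwo at h
  have hki : k ≠ i := by grind
  have hkj : k ≠ j := by grind
  have hli : l ≠ i := by grind
  have hlj : l ≠ j := by grind
  have hkl : k ≠ l := by grind
  have eij : a i = a j := le_antisymm (ha.1 j).1 (ha.1 i).2
  have ekl : a k = a l := le_antisymm (ha.2 l h.2.2.2.1).1 (ha.2 k h.2.2.1).2
  by_cases h1 : ∃ r, cl r ≠ cl i ∧ r ≠ k ∧ r ≠ l ∧ a r ≤ a k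
  · obtain ⟨r, hr, hrk, hrl, hle⟩ := h1
    exact ⟨Pi.single r 1, fun t ht => pairMin_add_single (by grind) (by grind) hrk hrl ha ht,
      fun t ht => not_hasDoubleMinima_sub_single hr (fun s hs => hle.trans (ha.2 s hs).1) ht⟩
  by_cases h2 : ∃ r, r ≠ i ∧ r ≠ j ∧ r ≠ k ∧ r ≠ l ∧ a r ≤ a i
  · obtain ⟨r, hri, hrj, hrk, hrl, hle⟩ := h2
    obtain ⟨c, hc⟩ := exists_ne (cl r)
    exact ⟨Pi.single r 1, fun t ht => pairMin_add_single hri hrj hrk hrl ha ht,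
      fun t ht => not_hasDoubleMinima_sub_single hc.symm (fun s _ => hle.trans (ha.1 s).1) ht⟩
  have h3 : a k ≤ a i := by
    by_contra! h3
    exact ha' ⟨⟨eij, ekl⟩, by grind, by grind⟩
  push Not at h1
  clear ha' h2
  -- Now `a k = a i`, and `k`, `l` are the only minimizers outside the class of `i`. Lowering
  -- everything outside that class puts `k`, `l` strictly below the rest, so outside the class of
  -- `k` the minimum is attained at `l` alone.
  refine ⟨fun s => if cl s = cl i then 0 else 1, fun t ht => ⟨fun s => ?_, fun s hs => ?_⟩,
    fun t ht => ?_⟩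
  · have := ha.1 s
    by_cases hs : cl s = cl i
    · simpa [hs, ← h.2.1] using this
    · simp only [Pi.add_apply, Pi.smul_apply, smul_eq_mul, hs, ← h.2.1, if_true, if_false]
      constructor <;> linarith
  · simpa [hs, h.2.2.1, h.2.2.2.1] using ha.2 s hs
  · refine not_hasDoubleMinima_of_unique (c := cl k) (r := l) h.2.2.2.2.symm fun s hs hsc => ?_
    have := ha.1 s
    simp only [Pi.sub_apply, Pi.smul_apply, smul_eq_mul, h.2.2.2.1, if_false]
    by_cases hsi : cl s = cl i
    · simp only [hsi, if_true]
      linarith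
    · have := h1 s hsi (by grind) hs
      simp only [hsi, if_false]
      linarith

theorem mem_twoPairs_iff :
    a ∈ orderCone (twoEqualities i j k l) (twoPairsIneq cl i j k l) ↔
      (a i = a j ∧ a k = a l) ∧ (∀ s, cl s ≠ cl k → a i ≤ a s) ∧
        ∀ s, cl s ≠ cl i → a k ≤ a s := by
  simp only [orderCone, Set.mem_ofPred_eq, forall_twoEqualities, twoPairsIneq]
  constructor
  · rintro ⟨h1, h2⟩
    refine ⟨h1, fun s hs => ?_, fun s hs => ?_⟩
    · have := h2 i s
      grind
    · have := h2 k s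
      grind
  · rintro ⟨h1, h2, h3⟩
    exact ⟨h1, by grind⟩

theorem exists_ray_twoPairs (h : TwoPairs cl i j k l)
    (ha : a ∈ orderCone (twoEqualities i j k l) (twoPairsIneq cl i j k l))
    (ha' : a ∉ strictOrderCone (twoEqualities i j k l) (twoPairsIneq cl i j k l)) :
    ∃ e : ι → ℝ, (∀ t : ℝ, 0 < t →
        a + t • e ∈ orderCone (twoEqualities i j k l) (twoPairsIneq cl i j k l)) ∧
      ∀ t : ℝ, 0 < t → ¬ HasDoubleMinima cl (a - t • e) := by
  classical
  rw [mem_twoPairs_strict] at ha'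
  rw [mem_twoPairs_iff] at ha
  unfold TwoPairs at h
  have mem : ∀ r, r ≠ i → r ≠ j → r ≠ k → r ≠ l → ∀ t : ℝ, 0 < t → a + t • Pi.single r 1 ∈
      orderCone (twoEqualities i j k l) (twoPairsIneq cl i j k l) := by
    intro r hi hj hk hl t ht
    have hs : ∀ s, (a + t • (Pi.single r 1 : ι → ℝ)) s = if s = r then a s + t else a s := by
      intro s
      by_cases hs : s = r
      · subst hs; simp
      · simp [hs]
    rw [mem_twoPairs_iff]
    simp only [hs]
    grind
  by_cases h1 : ∃ r, cl r ≠ cl k ∧ r ≠ i ∧ r ≠ j ∧ a r ≤ a i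
  · obtain ⟨r, hrc, hri, hrj, hr⟩ := h1
    refine ⟨Pi.single r 1, mem r hri hrj (by grind) (by grind), fun t ht =>
      not_hasDoubleMinima_sub_single hrc (fun s hs => hr.trans (ha.2.1 s hs)) ht⟩
  by_cases h2 : ∃ r, cl r ≠ cl i ∧ r ≠ k ∧ r ≠ l ∧ a r ≤ a k
  · obtain ⟨r, hrc, hrk, hrl, hr⟩ := h2
    refine ⟨Pi.single r 1, mem r (by grind) (by grind) hrk hrl, fun t ht =>
      not_hasDoubleMinima_sub_single hrc (fun s hs => hr.trans (ha.2.2 s hs)) ht⟩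
  push Not at h1 h2
  exact absurd ⟨ha.1, h1, h2⟩ ha'

/-- Membership in a cell passes from `z` to `x`, up to the order of the pairs. -/
def CellTransfer (cl : ι → γ) (z x : ι → ℝ) : Prop :=
  (∀ i j k, ThreeClasses cl i j k → TripleMin i j k z → TripleMin i j k x) ∧
    ∀ i j k l, cl i = cl j → cl k ≠ cl i → cl l ≠ cl i → PairMin cl i j k l z →
      PairMin cl i j k l x ∨ (cl k = cl l ∧ PairMin cl k l i j x)

theorem cellTransfer_of_min {x z : ι → ℝ}
    (h₁ : ∀ r, (∀ s, z r ≤ z s) → ∀ s, x r ≤ x s)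
    (h₂ : ∀ c r, cl r ≠ c → (∀ s, cl s ≠ c → z r ≤ z s) → ∀ s, cl s ≠ c → x r ≤ x s) :
    CellTransfer cl z x := by
  refine ⟨fun i j k _ hz s => ?_, fun i j k l _ hk hl hz => .inl ⟨fun s => ?_, fun s hs => ?_⟩⟩
  · exact ⟨h₁ i (fun s => (hz s).1) s, h₁ j (fun s => (hz s).2.1) s, h₁ k (fun s => (hz s).2.2) s⟩
  · exact ⟨h₁ i (fun s => (hz.1 s).1) s, h₁ j (fun s => (hz.1 s).2) s⟩
  · exact ⟨h₂ _ k hk (fun s hs => (hz.2 s hs).1) s hs, h₂ _ l hl (fun s hs => (hz.2 s hs).2) s hs⟩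

theorem cellTransfer_triple {x z : ι → ℝ} (h : ThreeClasses cl i j k)
    (hx : TripleMin i j k x) (hz : TripleMin i j k z)
    (hact : ∀ r s, tripleIneq i j k r s → z r = z s → x r = x s) : CellTransfer cl z x := by
  have key : ∀ r, z r ≤ z i → ∀ s, x r ≤ x s := by
    intro r hr s
    have h1 := hz r
    have h2 := hx s
    by_cases hi : r = i
    · grind
    by_cases hj : r = j
    · grind
    by_cases hk : r = k
    · grind
    have := hact i r ⟨rfl, hi, hj, hk⟩ (by linarith)
    grind
  -- At most one of `i`, `j`, `k` lies in a given class `c`, so minimizers of `z` outside `c` are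
  -- global minimizers.
  refine cellTransfer_of_min (fun r hr => key r (hr i)) fun c r _ hr s _ => key r ?_ s
  unfold ThreeClasses at h
  by_cases hi : cl i = c
  · exact (hr j (by grind)).trans (hz i).2.1
  · exact hr i hi

theorem cellTransfer_pairAndTwo {x z : ι → ℝ} (h : PairAndTwo cl i j k l)
    (hx : PairMin cl i j k l x) (hz : PairMin cl i j k l z)
    (hact : ∀ r s, pairAndTwoIneq cl i j k l r s → z r = z s → x r = x s) :
    CellTransfer cl z x := by
  unfold PairAndTwo at h
  have key : ∀ r, z r ≤ z i → ∀ s, x r ≤ x s := by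
    intro r hr s
    have h1 := hz.1 r
    have h2 := hx.1 s
    by_cases hi : r = i
    · grind
    by_cases hj : r = j
    · grind
    have := hact i r (.inl ⟨rfl, hi, hj⟩) (by linarith)
    grind
  refine cellTransfer_of_min (fun r hr => key r (hr i)) fun c r hrc hr s hs => ?_
  -- Only `c = cl i` needs `k` and `l`: outside any other class the minimum is the global one,
  -- attained at `i`.
  by_cases hc : cl i = c
  · subst hc
    have h1 := hz.2 r hrc
    have h2 := hx.2 s hs
    have h3 := hr k h.2.2.1
    by_cases hk : r = k
    · grind
    by_cases hl : r = l
    · grind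
    have := hact k r (.inr ⟨rfl, hrc, hk, hl⟩) (by linarith)
    grind
  · exact key r (hr i hc) s

/-- A type III cone contains both orders of its pairs, so `x` may order them differently from `z`.
This is why the conclusion allows a swap. -/
theorem pairMin_or_pairMin_of_active {x z : ι → ℝ} (hki : cl k ≠ cl i)
    (hx₁ : ∀ s, cl s ≠ cl k → x i ≤ x s) (hx₂ : ∀ s, cl s ≠ cl i → x k ≤ x s)
    (hact₁ : ∀ s, cl s ≠ cl k → z s ≤ z i → x i = x s)
    (hact₂ : ∀ s, cl s ≠ cl i → z s ≤ z k → x k = x s)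
    (hcl : cl i' = cl j') (hk : cl k' ≠ cl i') (hl : cl l' ≠ cl i') (h1 : cl i' = cl i)
    (hz : PairMin cl i' j' k' l' z) :
    PairMin cl i' j' k' l' x ∨ (cl k' = cl l' ∧ PairMin cl k' l' i' j' x) := by
  have e₁ := hact₁ i' (by grind) (hz.1 i).1
  have e₂ := hact₁ j' (by grind) (hz.1 i).2
  have e₃ := hact₂ k' (by grind) (hz.2 k (by grind)).1
  have e₄ := hact₂ l' (by grind) (hz.2 k (by grind)).2
  rcases le_total (x i) (x k) with hle | hle
  · left
    refine ⟨fun s => ?_, fun s hs => ?_⟩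
    · have : x i ≤ x s := by
        by_cases hs : cl s = cl k
        · exact hle.trans (hx₂ s (by grind))
        · exact hx₁ s hs
      constructor <;> linarith
    · have := hx₂ s (by grind)
      constructor <;> linarith
  · have hle' : ∀ s, x k ≤ x s := by
      intro s
      by_cases hs : cl s = cl k
      · exact hx₂ s (by grind)
      · exact hle.trans (hx₁ s hs)
    by_cases hkl : cl k' = cl k ∧ cl l' = cl k
    · refine .inr ⟨hkl.1.trans hkl.2.symm, fun s => ?_, fun s hs => ?_⟩
      · have := hle' s
        constructor <;> linarith
      · have := hx₁ s (by grind)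
        constructor <;> linarith
    -- One of `k'`, `l'` lies outside the class of `k`, so its value, equal to `x k`, is at least `x
    -- i`. The two levels coincide and no swap is needed.
    · have : x i = x k := by
        refine le_antisymm ?_ hle
        by_cases hk' : cl k' = cl k
        · exact (hx₁ l' (by grind)).trans_eq e₄.symm
        · exact (hx₁ k' hk').trans_eq e₃.symm
      refine .inl ⟨fun s => ?_, fun s hs => ?_⟩ <;>
      · have := hle' s
        constructor <;> linarith

theorem cellTransfer_twoPairs {x z : ι → ℝ} (h : TwoPairs cl i j k l)
    (hx : x ∈ orderCone (twoEqualities i j k l) (twoPairsIneq cl i j k l))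
    (hz : z ∈ orderCone (twoEqualities i j k l) (twoPairsIneq cl i j k l))
    (hact : ∀ r s, twoPairsIneq cl i j k l r s → z r = z s → x r = x s) :
    CellTransfer cl z x := by
  have hact₁ : ∀ s, cl s ≠ cl k → z s ≤ z i → x i = x s := by
    intro s hs hle
    by_cases hi : s = i
    · rw [hi]
    by_cases hj : s = j
    · rw [hj]; exact hx.1 i j (.inl ⟨rfl, rfl⟩)
    have hR : twoPairsIneq cl i j k l i s := .inl ⟨rfl, hs, hi, hj⟩
    exact hact i s hR ((hz.2 i s hR).antisymm hle)
  have hact₂ : ∀ s, cl s ≠ cl i → z s ≤ z k → x k = x s := by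
    intro s hs hle
    by_cases hk : s = k
    · rw [hk]
    by_cases hl : s = l
    · rw [hl]; exact hx.1 k l (.inr ⟨rfl, rfl⟩)
    have hR : twoPairsIneq cl i j k l k s := .inr ⟨rfl, hs, hk, hl⟩
    exact hact k s hR ((hz.2 k s hR).antisymm hle)
  have hki := h.2.2.1
  rw [mem_twoPairs_iff] at hx hz
  obtain ⟨-, hx₁, hx₂⟩ := hx
  obtain ⟨-, hz₁, hz₂⟩ := hz
  clear hact h
  -- A minimizer `r` of `z` outside both classes makes comparisons with `i` and with `k` active, so
  -- `x i = x r = x k` is the minimum of `x`, and minimizers of `z` remain minimizers of `x`.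
  have other : ∀ r, cl r ≠ cl i → cl r ≠ cl k → (∀ s, z r ≤ z s) → CellTransfer cl z x := by
    intro r hri hrk hr
    have e₁ := hact₁ r hrk (hr i)
    have e₂ := hact₂ r hri (hr k)
    have key : ∀ q, z q ≤ z r → ∀ s, x q ≤ x s := by
      intro q hq s
      have h1 := hr i
      have h2 := hr k
      have hqi : x q = x i := by
        by_cases hqk : cl q = cl k
        · rw [← hact₂ q (by grind) (by linarith)]
          linarith
        · exact (hact₁ q hqk (by linarith)).symm
      by_cases hs : cl s = cl k
      · have := hx₂ s (by grind)
        linarith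
      · have := hx₁ s hs
        linarith
    refine cellTransfer_of_min (fun q hq => key q (hq r)) fun c q _ hq s _ => key q ?_ s
    by_cases hc : cl i = c
    · exact (hq k (by grind)).trans (hz₂ r hri)
    · exact (hq i hc).trans (hz₁ r hrk)
  refine ⟨fun i' j' k' h' hz => ?_, fun i' j' k' l' hcl hk hl hz => ?_⟩
  -- Of three minimizers in distinct classes, one avoids the classes of both `i` and `k`.
  · obtain ⟨r, hri, hrk, hr⟩ : ∃ r, cl r ≠ cl i ∧ cl r ≠ cl k ∧ ∀ s, z r ≤ z s := by
      unfold ThreeClasses at h'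
      by_cases h1 : cl i' ≠ cl i ∧ cl i' ≠ cl k
      · exact ⟨i', h1.1, h1.2, fun s => (hz s).1⟩
      by_cases h2 : cl j' ≠ cl i ∧ cl j' ≠ cl k
      · exact ⟨j', h2.1, h2.2, fun s => (hz s).2.1⟩
      · exact ⟨k', by grind, by grind, fun s => (hz s).2.2⟩
    exact (other r hri hrk hr).1 i' j' k' h' hz
  · by_cases h1 : cl i' = cl i
    · exact pairMin_or_pairMin_of_active hki hx₁ hx₂ hact₁ hact₂ hcl hk hl h1 hz
    by_cases h2 : cl i' = cl k
    · exact pairMin_or_pairMin_of_active hki.symm hx₂ hx₁ hact₂ hact₁ hcl hk hl h2 hz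
    exact (other i' h1 h2 fun s => (hz.1 s).1).2 i' j' k' l' hcl hk hl hz

end DoubleMinimaCones

/-! ### Generic units and the value group. -/

section ValuedLifts

variable {K : Type*} [Field K] {v : AddValuation K (WithTop ℝ)}

theorem AddValuation.eq_zero_of_pow_eq_one {u : K} {m : ℕ} (hm : m ≠ 0) (hu : u ^ m = 1) :
    v u = 0 := by
  have hu0 : u ≠ 0 := by rintro rfl; simp [hm] at hu
  have h := v.map_pow u m
  rw [hu, v.map_one] at h
  obtain ⟨r, hr⟩ := WithTop.ne_top_iff_exists.1 ((v.ne_top_iff).2 hu0)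
  rw [← hr] at h ⊢
  norm_cast at h ⊢
  simpa [hm] using h.symm

theorem AddValuation.map_zmodCast_eq_zero {p : ℕ} [Fact p.Prime] [CharP K p] {x : ZMod p}
    (hx : x ≠ 0) : v (ZMod.castHom dvd_rfl K x) = 0 := by
  refine AddValuation.eq_zero_of_pow_eq_one (m := p - 1) ?_ ?_
  · have := (Fact.out : p.Prime).two_le
    omega
  · rw [← _root_.map_pow, ZMod.pow_card_sub_one_eq_one hx, _root_.map_one]

/-- There is an infinite set containing `0` in which all differences have valuation `0`. -/
theorem AddValuation.exists_infinite_units [IsAlgClosed K] (v : AddValuation K (WithTop ℝ))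
    (p : ℕ) [Fact p.Prime] [CharP K p] :
    ∃ s : Set K, s.Infinite ∧ 0 ∈ s ∧ ∀ x ∈ s, ∀ y ∈ s, x ≠ y → v (x - y) = 0 := by
  let _ : Algebra (ZMod p) K := ZMod.algebra K p
  -- In the image of the algebraic closure of `𝔽_p`, a nonzero difference lies in a finite field, so
  -- it is a root of unity and has valuation `0`.
  let f : AlgebraicClosure (ZMod p) →ₐ[ZMod p] K := IsAlgClosed.lift
  have hf : Function.Injective f := f.toRingHom.injective
  refine ⟨Set.range f, Set.infinite_range_of_injective hf, ⟨0, _root_.map_zero f⟩, ?_⟩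
  rintro _ ⟨x, rfl⟩ _ ⟨y, rfl⟩ hxy
  have hne : x - y ≠ 0 := sub_ne_zero.2 fun h => hxy (h ▸ rfl)
  let E := IntermediateField.adjoin (ZMod p) {x - y}
  have : FiniteDimensional (ZMod p) E := IntermediateField.adjoin.finiteDimensional
    (Algebra.IsIntegral.isIntegral _)
  have : Finite E := Module.finite_of_finite (ZMod p)
  let z : E := ⟨x - y, IntermediateField.mem_adjoin_simple_self _ _⟩
  have hz : z ≠ 0 := fun h => hne (congrArg Subtype.val h)
  have h0 : Units.mk0 z hz ^ Nat.card Eˣ = 1 := pow_card_eq_one'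
  have h1 : z ^ Nat.card Eˣ = 1 := by
    simpa only [Units.val_pow_eq_pow_val, Units.val_mk0, Units.val_one] using congrArg Units.val h0
  refine AddValuation.eq_zero_of_pow_eq_one (m := Nat.card Eˣ) Nat.card_pos.ne' ?_
  have h2 : (x - y) ^ Nat.card Eˣ = 1 := congrArg Subtype.val h1
  rw [← _root_.map_sub f, ← _root_.map_pow f, h2, _root_.map_one f]

/-- For finitely many affine functions with integral coefficients and unit slopes there is a unit
at which all of their values are units. -/
theorem AddValuation.exists_generic_unit [IsAlgClosed K] (v : AddValuation K (WithTop ℝ))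
    (p : ℕ) [Fact p.Prime] [CharP K p] {ι : Type*} [Finite ι] (α β : ι → K)
    (hα : ∀ i, 0 ≤ v (α i)) (hβ : ∀ i, v (β i) = 0) :
    ∃ u, v u = 0 ∧ ∀ i, v (α i + β i * u) = 0 := by
  obtain ⟨s, hs, h0, hsub⟩ := v.exists_infinite_units p
  have hnonneg : ∀ x ∈ s, 0 ≤ v x := by
    intro x hx
    by_cases h : x = 0
    · simp [h]
    · have := hsub x hx 0 h0 h
      rw [sub_zero] at this
      exact this.ge
  let bad : ι → Set K := fun i => {u ∈ s | v (α i + β i * u) ≠ 0}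
  -- Each affine function excludes at most one candidate: for two bad ones, subtracting the values
  -- would give `β i * (x - y)` positive valuation.
  have hbad : ∀ i, (bad i).Subsingleton := by
    rintro i x ⟨hx, hx'⟩ y ⟨hy, hy'⟩
    by_contra hxy
    have hpos : ∀ u ∈ s, v (α i + β i * u) ≠ 0 → 0 < v (α i + β i * u) := by
      intro u hu hne
      refine lt_of_le_of_ne (v.map_le_add (hα i) ?_) hne.symm
      rw [v.map_mul, hβ, zero_add]
      exact hnonneg u hu
    have h1 := v.map_lt_add (hpos x hx hx') (by rw [v.map_neg]; exact hpos y hy hy' :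
      0 < v (-(α i + β i * y)))
    have h2 : α i + β i * x + -(α i + β i * y) = β i * (x - y) := by ring
    rw [h2, v.map_mul, hβ, hsub x hx y hy hxy, add_zero] at h1
    exact lt_irrefl _ h1
  have hfin : ({0} ∪ ⋃ i, bad i).Finite :=
    (Set.finite_singleton 0).union (Set.finite_iUnion fun i => (hbad i).finite)
  obtain ⟨u, hu, hu'⟩ := (hs.sdiff hfin).nonempty
  simp only [Set.mem_union, Set.mem_singleton_iff, Set.mem_iUnion, not_or, not_exists] at hu'
  refine ⟨u, ?_, fun i => by_contra fun h => hu'.2 i ⟨hu, h⟩⟩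
  have := hsub u hu 0 h0 hu'.1
  rwa [sub_zero] at this

theorem AddValuation.exists_generic [IsAlgClosed K] (v : AddValuation K (WithTop ℝ))
    (p : ℕ) [Fact p.Prime] [CharP K p] {ι : Type*} [Finite ι] {x : K} (hx : x ≠ 0) (α β : ι → K)
    (hα : ∀ i, v x ≤ v (α i)) (hβ : ∀ i, v (β i) = 0) :
    ∃ u, v u = v x ∧ ∀ i, v (α i + β i * u) = v x := by
  have hdiv : ∀ y, v x ≤ v y → 0 ≤ v (y / x) := by
    intro y hy
    have h : v (y / x) + v x = v y := by rw [← v.map_mul, div_mul_cancel₀ _ hx]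
    by_contra! hlt
    have := WithTop.add_lt_add_right ((v.ne_top_iff).2 hx) hlt
    rw [h, zero_add] at this
    exact this.not_ge hy
  obtain ⟨u, hu, hu'⟩ := v.exists_generic_unit p (fun i => α i / x) β (fun i => hdiv _ (hα i)) hβ
  refine ⟨u * x, by rw [v.map_mul, hu, zero_add], fun i => ?_⟩
  have h : α i + β i * (u * x) = (α i / x + β i * u) * x := by field_simp
  rw [h, v.map_mul, hu', zero_add]

/-- In a vanishing sum the minimal valuation is attained twice. -/
theorem AddValuation.exists_ne_le_of_sum_eq_zero {ι : Type*} {s : Finset ι} {f : ι → K}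
    (hsum : ∑ i ∈ s, f i = 0) {r : ι} (hr : r ∈ s) (hfr : f r ≠ 0) :
    ∃ q ∈ s, q ≠ r ∧ v (f q) ≤ v (f r) := by
  classical
  by_contra! hcon
  have h1 : v (f r) < v (∑ i ∈ s.erase r, f i) :=
    v.map_lt_sum ((v.ne_top_iff).2 hfr) fun i hi =>
      hcon i (Finset.mem_of_mem_erase hi) (Finset.ne_of_mem_erase hi)
  rw [← Finset.add_sum_erase s f hr, add_eq_zero_iff_neg_eq] at hsum
  rw [← hsum, v.map_neg] at h1
  exact lt_irrefl _ h1

/-- The entries of a tuple at `k` and `l` can be changed, keeping their valuations, so that a weighted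
sum vanishes. -/
theorem AddValuation.exists_sum_eq_zero [IsAlgClosed K] (v : AddValuation K (WithTop ℝ))
    (p : ℕ) [Fact p.Prime] [CharP K p] {ι : Type*} [Fintype ι] (A w : ι → K) {k l : ι}
    (hkl : k ≠ l) (hA : A k ≠ 0) (hvkl : v (A k) = v (A l)) (hk : v (w k) = 0) (hl : v (w l) = 0)
    (hw : ∀ r, w r ≠ 0 → v (w r) = 0 ∧ v (A k) ≤ v (A r)) :
    ∃ A' : ι → K, (∀ r, r ≠ k → r ≠ l → A' r = A r) ∧ (∀ r, v (A' r) = v (A r)) ∧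
      ∑ r, w r * A' r = 0 := by
  classical
  have hwl : w l ≠ 0 := by rw [← v.ne_top_iff, hl]; exact WithTop.zero_ne_top
  let S := ∑ r ∈ (Finset.univ.erase l).erase k, w r * A r
  have hdiv : ∀ y, v (y / w l) = v y := by
    intro y
    have h : v (y / w l) + v (w l) = v y := by rw [← v.map_mul, div_mul_cancel₀ _ hwl]
    rwa [hl, add_zero] at h
  have hS : v (A k) ≤ v S := by
    refine v.map_le_sum fun r _ => ?_
    by_cases h : w r = 0
    · simp [h]
    · rw [v.map_mul, (hw r h).1, zero_add]
      exact (hw r h).2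
  -- `u` is the new entry at `k`; the entry at `l` is then forced by the equation, and genericity of
  -- `u` gives it the right valuation.
  obtain ⟨u, hu, hu'⟩ := v.exists_generic p (ι := Unit) hA (fun _ => S / w l)
    (fun _ => w k / w l) (fun _ => by rwa [hdiv]) (fun _ => by rwa [hdiv])
  refine ⟨Function.update (Function.update A k u) l (-(S / w l + w k / w l * u)),
    fun r hk hl => by simp [hk, hl], fun r => ?_, ?_⟩
  · by_cases h : r = l
    · subst h
      rw [Function.update_self, v.map_neg, hu' (), hvkl]
    by_cases h' : r = k
    · subst h'
      rw [Function.update_of_ne h, Function.update_self, hu]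
    · rw [Function.update_of_ne h, Function.update_of_ne h']
  · rw [← Finset.add_sum_erase _ _ (Finset.mem_univ l), ← Finset.add_sum_erase _ _
      (Finset.mem_erase.2 ⟨hkl, Finset.mem_univ k⟩)]
    have : ∑ r ∈ (Finset.univ.erase l).erase k, w r * Function.update (Function.update A k u) l
        (-(S / w l + w k / w l * u)) r = S := by
      refine Finset.sum_congr rfl fun r hr => ?_
      simp only [Finset.mem_erase] at hr
      rw [Function.update_of_ne hr.2.1, Function.update_of_ne hr.1]
    rw [this, Function.update_self, Function.update_of_ne hkl, Function.update_self]
    field_simp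
    ring

/-- An `N`-th root divides the value by `N`, so the value group has arbitrarily small positive
elements. -/
theorem AddValuation.exists_pos_lt [IsAlgClosed K] (hv : ∃ x : K, x ≠ 0 ∧ v x ≠ 0) {ε : ℝ}
    (hε : 0 < ε) : ∃ (x : K) (t : ℝ), v x = t ∧ 0 < t ∧ t < ε := by
  obtain ⟨y, t, hy, ht⟩ : ∃ (y : K) (t : ℝ), v y = t ∧ 0 < t := by
    obtain ⟨x, hx, hx0⟩ := hv
    obtain ⟨t, ht⟩ := WithTop.ne_top_iff_exists.1 ((v.ne_top_iff).2 hx)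
    rw [← ht] at hx0
    norm_cast at hx0
    rcases lt_or_gt_of_ne hx0 with h | h
    · refine ⟨x⁻¹, -t, ?_, by linarith⟩
      have h1 : v x⁻¹ + v x = 0 := by rw [← v.map_mul, inv_mul_cancel₀ hx, v.map_one]
      obtain ⟨t', ht'⟩ := WithTop.ne_top_iff_exists.1 ((v.ne_top_iff).2 (inv_ne_zero hx))
      rw [← ht, ← ht'] at h1
      rw [← ht']
      norm_cast at h1 ⊢
      linarith
    · exact ⟨x, t, ht.symm, h⟩
  obtain ⟨N, hN⟩ := exists_nat_gt (t / ε)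
  have hN0 : (0 : ℝ) < N := (div_pos ht hε).trans hN
  have hNpos : 0 < N := by exact_mod_cast hN0
  obtain ⟨x, hx⟩ := IsAlgClosed.exists_pow_nat_eq y hNpos
  have h1 := v.map_pow x N
  rw [hx, hy] at h1
  have hx0 : v x ≠ ⊤ := by
    rw [v.ne_top_iff]
    rintro rfl
    rw [zero_pow hNpos.ne'] at hx
    rw [← hx, v.map_zero] at hy
    exact WithTop.top_ne_coe hy
  obtain ⟨q, hq⟩ := WithTop.ne_top_iff_exists.1 hx0
  rw [← hq] at h1
  norm_cast at h1
  rw [nsmul_eq_mul] at h1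
  refine ⟨x, q, hq.symm, ?_, ?_⟩
  · by_contra! hcon
    nlinarith
  · rw [div_lt_iff₀ hε] at hN
    by_contra! hcon
    nlinarith

theorem AddValuation.exists_map_eq_intCast_mul {x : K} {t : ℝ} (hx : v x = t) (m : ℤ) :
    ∃ y : K, v y = ((m * t : ℝ) : WithTop ℝ) := by
  have hx0 : x ≠ 0 := by rw [← v.ne_top_iff, hx]; exact WithTop.coe_ne_top
  have hnat : ∀ n : ℕ, v (x ^ n) = ((n * t : ℝ) : WithTop ℝ) := by
    intro n
    rw [v.map_pow, hx]
    norm_cast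
    rw [nsmul_eq_mul]
  obtain ⟨n, rfl | rfl⟩ := m.eq_nat_or_neg
  · exact ⟨x ^ n, by simpa using hnat n⟩
  · refine ⟨(x ^ n)⁻¹, ?_⟩
    have h1 : v (x ^ n)⁻¹ + v (x ^ n) = 0 := by
      rw [← v.map_mul, inv_mul_cancel₀ (pow_ne_zero n hx0), v.map_one]
    obtain ⟨q, hq⟩ := WithTop.ne_top_iff_exists.1
      ((v.ne_top_iff).2 (inv_ne_zero (pow_ne_zero n hx0)))
    rw [hnat, ← hq] at h1
    rw [← hq]
    norm_cast at h1 ⊢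
    push_cast
    linarith

end ValuedLifts

/-! ### Double roots as two vanishing sums, and their lifts. -/

section DoubleRootLifts

variable {K : Type*} [Field K] {v : AddValuation K (WithTop ℝ)} {ι γ : Type*}

/-- The relation `∑ (N r - M c) A r = 0` kills class `c` and has unit weights elsewhere; in a
vanishing sum the minimal valuation occurs twice. -/
theorem hasDoubleMinima_of_sum_eq_zero [Fintype ι] {cl : ι → γ} {a : ι → ℝ} {A N : ι → K}
    {M : γ → K} (hA : ∀ r, v (A r) = a r) (hsum : ∑ r, A r = 0) (hsum' : ∑ r, N r * A r = 0)
    (hN : ∀ r, N r = M (cl r)) (hM : ∀ r c, cl r ≠ c → v (M (cl r) - M c) = 0) :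
    HasDoubleMinima cl a := by
  intro c r hr
  have hne : ∀ r, A r ≠ 0 := fun r => by rw [← v.ne_top_iff, hA]; exact WithTop.coe_ne_top
  have hval : ∀ r, cl r ≠ c → v ((N r - M c) * A r) = a r := by
    intro r hr
    rw [v.map_mul, hN, hM r c hr, zero_add, hA]
  have h : ∑ r, (N r - M c) * A r = 0 := by
    simp only [sub_mul, Finset.sum_sub_distrib, ← Finset.mul_sum, hsum, hsum', mul_zero, sub_zero]
  have hnz : (N r - M c) * A r ≠ 0 := by
    rw [← v.ne_top_iff, hval r hr]
    exact WithTop.coe_ne_top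
  obtain ⟨s, -, hsr, hle⟩ := AddValuation.exists_ne_le_of_sum_eq_zero (v := v) h
    (Finset.mem_univ r) hnz
  by_cases hs : cl s = c
  · rw [hN, hs, sub_self, zero_mul, v.map_zero, hval r hr] at hle
    exact absurd hle (WithTop.coe_lt_top _).not_ge
  · rw [hval r hr, hval s hs] at hle
    exact ⟨s, hsr, hs, by exact_mod_cast hle⟩

/-- The weights `N r - M (cl i)` vanish on the class of `i`. Correcting the entries at `k`, `l`
kills this weighted sum, and correcting those at `i`, `j` afterwards kills the plain sum without
disturbing it. -/
theorem PairMin.exists_lift [IsAlgClosed K] (p : ℕ) [Fact p.Prime] [CharP K p] [Fintype ι]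
    {cl : ι → γ} {a : ι → ℝ} {A N : ι → K} {M : γ → K} (hA : ∀ r, v (A r) = a r)
    (hN : ∀ r, N r = M (cl r)) (hM : ∀ r c, cl r ≠ c → v (M (cl r) - M c) = 0) {i j k l : ι}
    (hij : i ≠ j) (hcl : cl i = cl j) (hk : cl k ≠ cl i) (hl : cl l ≠ cl i) (hkl : k ≠ l)
    (ha : PairMin cl i j k l a) :
    ∃ A : ι → K, (∀ r, v (A r) = a r) ∧ ∑ r, A r = 0 ∧ ∑ r, N r * A r = 0 := by
  have hne : ∀ A : ι → K, (∀ r, v (A r) = a r) → ∀ r, A r ≠ 0 := fun A hA r => by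
    rw [← v.ne_top_iff, hA]
    exact WithTop.coe_ne_top
  have eij : a i = a j := le_antisymm (ha.1 j).1 (ha.1 i).2
  have ekl : a k = a l := le_antisymm (ha.2 l hl).1 (ha.2 k hk).2
  obtain ⟨A₁, -, hA₁, hsum₁⟩ := v.exists_sum_eq_zero p A (fun r => N r - M (cl i)) hkl (hne A hA k)
    (by rw [hA, hA, ekl]) (by rw [hN]; exact hM k _ hk) (by rw [hN]; exact hM l _ hl) (by
      intro r hr
      have hri : cl r ≠ cl i := fun h => hr (by rw [hN, h, sub_self])
      refine ⟨by rw [hN]; exact hM r _ hri, ?_⟩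
      rw [hA, hA]
      exact_mod_cast (ha.2 r hri).1)
  simp only [hA] at hA₁
  obtain ⟨A₂, hA₂₁, hA₂, hsum₂⟩ := v.exists_sum_eq_zero p A₁ (fun _ => 1) hij (hne A₁ hA₁ i)
    (by rw [hA₁, hA₁, eij]) v.map_one v.map_one (by
      intro r _
      refine ⟨v.map_one, ?_⟩
      rw [hA₁, hA₁]
      exact_mod_cast (ha.1 r).1)
  simp only [hA₁] at hA₂
  simp only [one_mul] at hsum₂
  refine ⟨A₂, hA₂, hsum₂, ?_⟩
  have h : ∑ r, (N r - M (cl i)) * A₂ r = ∑ r, (N r - M (cl i)) * A₁ r := by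
    refine Finset.sum_congr rfl fun r _ => ?_
    by_cases hri : cl r = cl i
    · rw [hN, hri, sub_self, zero_mul, zero_mul]
    · rw [hA₂₁ r (by rintro rfl; exact hri rfl) (by rintro rfl; exact hri hcl.symm)]
  rw [hsum₁] at h
  simpa only [sub_mul, Finset.sum_sub_distrib, ← Finset.mul_sum, hsum₂, mul_zero, sub_zero] using h

theorem TripleMin.exists_lift [IsAlgClosed K] (p : ℕ) [Fact p.Prime] [CharP K p] [Fintype ι]
    {cl : ι → γ} {a : ι → ℝ} {A N : ι → K} {M : γ → K} (hA : ∀ r, v (A r) = a r)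
    (hN : ∀ r, N r = M (cl r)) (hM : ∀ r c, cl r ≠ c → v (M (cl r) - M c) = 0) {i j k : ι}
    (h : ThreeClasses cl i j k) (ha : TripleMin i j k a) :
    ∃ A : ι → K, (∀ r, v (A r) = a r) ∧ ∑ r, A r = 0 ∧ ∑ r, N r * A r = 0 := by
  classical
  obtain ⟨hij, hik, hjk⟩ := h
  have eij : a i = a j := le_antisymm (ha j).1 (ha i).2.1
  have eik : a i = a k := le_antisymm (ha k).1 (ha i).2.2
  have ij : j ≠ i := by rintro rfl; exact hij rfl
  have ik : k ≠ i := by rintro rfl; exact hik rfl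
  have jk : k ≠ j := by rintro rfl; exact hjk rfl
  have hAi : A i ≠ 0 := by rw [← v.ne_top_iff, hA]; exact WithTop.coe_ne_top
  have hle : ∀ r, v (A i) ≤ v (A r) := fun r => by
    rw [hA, hA]
    exact_mod_cast (ha r).1
  let w : ι → K := fun r => N r - N i
  have hw : ∀ r, 0 ≤ v (w r) := by
    intro r
    by_cases hr : cl r = cl i
    · simp [w, hN, hr]
    · simp only [w, hN]
      exact (hM r _ hr).ge
  have hwj : v (w j) = 0 := by simp only [w, hN]; exact hM j _ (Ne.symm hij)
  have hwk : v (w k) = 0 := by simp only [w, hN]; exact hM k _ (Ne.symm hik)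
  have hwk0 : w k ≠ 0 := by rw [← v.ne_top_iff, hwk]; exact WithTop.zero_ne_top
  have hdiv : ∀ y, v (y / w k) = v y := by
    intro y
    have h : v (y / w k) + v (w k) = v y := by rw [← v.map_mul, div_mul_cancel₀ _ hwk0]
    rwa [hwk, add_zero] at h
  let T : Finset ι := ((Finset.univ.erase i).erase j).erase k
  have hsum : ∀ f : ι → K, ∑ r, f r = f i + (f j + (f k + ∑ r ∈ T, f r)) := by
    intro f
    rw [Finset.add_sum_erase _ _ (by simp [ik, jk]), Finset.add_sum_erase _ _ (by simp [ij]),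
      Finset.add_sum_erase _ _ (Finset.mem_univ i)]
  have hS : v (A i) ≤ v (∑ r ∈ T, A r) := v.map_le_sum fun r _ => hle r
  have hS' : v (A i) ≤ v (∑ r ∈ T, w r * A r) := v.map_le_sum fun r _ => by
    rw [v.map_mul]
    exact le_add_of_nonneg_of_le (hw r) (hle r)
  set S := ∑ r ∈ T, A r with hSdef
  set S' := ∑ r ∈ T, w r * A r with hSdef'
  -- `u` is the entry at `j`. The weighted sum, with weight `0` at `i`, determines the entry at `k`,
  -- and the plain sum then determines the one at `i`. Both are affine in `u`; distinctness of the
  -- three classes makes the slopes units.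
  obtain ⟨u, hu, hu'⟩ := v.exists_generic p (ι := Bool) hAi
    (fun b => if b then S' / w k else S - S' / w k)
    (fun b => if b then w j / w k else (w k - w j) / w k)
    (by
      rintro (_ | _)
      · exact v.map_le_sub hS (by rwa [hdiv])
      · simpa [hdiv] using hS')
    (by
      rintro (_ | _)
      · have : w k - w j = M (cl k) - M (cl j) := by simp only [w, hN]; ring
        simp only [hdiv, this, Bool.false_eq_true, if_false]
        exact hM k _ (Ne.symm hjk)
      · simp [hdiv, hwj])
  have hk := hu' true
  have hi := hu' false
  simp only [if_true, Bool.false_eq_true, if_false] at hk hi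
  let A' : ι → K := fun r => if r = i then -(S - S' / w k + (w k - w j) / w k * u) else
    if r = j then u else if r = k then -(S' / w k + w j / w k * u) else A r
  have ei : A' i = -(S - S' / w k + (w k - w j) / w k * u) := by simp [A']
  have ej : A' j = u := by simp [A', ij]
  have ek : A' k = -(S' / w k + w j / w k * u) := by simp [A', ik, jk]
  have eT : ∀ r ∈ T, A' r = A r := by
    intro r hr
    simp only [T, Finset.mem_erase] at hr
    simp [A', hr.1, hr.2.1, hr.2.2.1]
  have h1 : ∑ r, A' r = 0 := by
    rw [hsum, ei, ej, ek, Finset.sum_congr rfl eT, ← hSdef]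
    field_simp
    ring
  have h2 : ∑ r, w r * A' r = 0 := by
    rw [hsum, ej, ek, Finset.sum_congr rfl fun r hr => by rw [eT r hr], ← hSdef']
    simp only [w, sub_self, zero_mul, zero_add]
    change w j * u + (w k * -(S' / w k + w j / w k * u) + S') = 0
    field_simp
    ring
  refine ⟨A', fun r => ?_, h1, ?_⟩
  · by_cases hri : r = i
    · rw [hri, ei, v.map_neg, hi, hA]
    by_cases hrj : r = j
    · rw [hrj, ej, hu, hA, eij]
    by_cases hrk : r = k
    · rw [hrk, ek, v.map_neg, hk, hA, eik]
    · rw [eT r (by simp [T, hri, hrj, hrk]), hA]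
  · simpa only [w, sub_mul, Finset.sum_sub_distrib, ← Finset.mul_sum, h1, mul_zero, sub_zero]
      using h2

/-- A double root of valuation `0` is the same as a vanishing sum with a vanishing weighted sum. -/
theorem isTropicalDoubleRoot_zero_iff {n : ℕ} {a : Fin (n + 1) → ℝ} :
    IsTropicalDoubleRoot v a 0 ↔ ∃ A : Fin (n + 1) → K, (∀ r, v (A r) = a r) ∧
      ∑ r, A r = 0 ∧ ∑ r : Fin (n + 1), ((r : ℕ) : K) * A r = 0 := by
  constructor
  · rintro ⟨F, hF, hcoeff, B, hB, h1, h2⟩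
    refine ⟨fun r => F.coeff r * B ^ (r : ℕ), fun r => ?_, ?_, ?_⟩
    · rw [v.map_mul, hcoeff, v.map_pow, hB]
      simp
    · rw [eval_eq_sum_range, hF] at h1
      rw [← h1, Finset.sum_range]
    · have h3 : ∑ r ∈ Finset.range (n + 1), F.coeff r * r * B ^ (r - 1) = 0 := by
        rw [← h2, derivative_eval, sum_over_range' _ _ (n + 1) (by omega)]
        simp
      -- Multiplying `F'(B) = 0` by `B` restores the exponent `r`; at `r = 0`, where `r - 1`
      -- truncates, the factor `r` kills the term.
      have h4 := congrArg (B * ·) h3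
      simp only [mul_zero, Finset.mul_sum] at h4
      rw [← h4, Finset.sum_range]
      refine Finset.sum_congr rfl fun r _ => ?_
      rcases Nat.eq_zero_or_pos (r : ℕ) with h | h
      · simp [h]
      · dsimp only
        rw [← mul_pow_sub_one h.ne' B]
        ring
  · rintro ⟨A, hA, h1, h2⟩
    let F : K[X] := ∑ r : Fin (n + 1), C (A r) * X ^ (r : ℕ)
    have hcoeff : ∀ m, F.coeff m = if h : m < n + 1 then A ⟨m, h⟩ else 0 := by
      intro m
      simp only [F, finsetSum_coeff, coeff_C_mul, coeff_X_pow]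
      split_ifs with h
      · rw [Finset.sum_eq_single ⟨m, h⟩]
        · simp
        · intro r _ hr
          have : m ≠ r := fun h => hr (Fin.ext h.symm)
          simp [this]
        · simp
      · refine Finset.sum_eq_zero fun r _ => ?_
        have : m ≠ r := by have := r.2; omega
        simp [this]
    have hcoeff' : ∀ r : Fin (n + 1), F.coeff r = A r := fun r => by
      rw [hcoeff, dif_pos r.2]
    refine ⟨F, ?_, fun r => by rw [hcoeff', hA], 1, by simp [v.map_one], ?_, ?_⟩
    · refine natDegree_eq_of_le_of_coeff_ne_zero ?_ ?_
      · rw [natDegree_le_iff_coeff_eq_zero]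
        intro m hm
        rw [hcoeff, dif_neg (by omega)]
      · have := hcoeff' (Fin.last n)
        rw [Fin.val_last] at this
        rw [this, ← v.ne_top_iff, hA]
        exact WithTop.coe_ne_top
    · simpa [F, eval_finsetSum] using h1
    · rw [← h2]
      simp only [F, derivative_sum, eval_finsetSum, derivative_C_mul_X_pow, eval_mul, eval_C,
        eval_pow, eval_X, one_pow, mul_one]
      exact Finset.sum_congr rfl fun r _ => mul_comm _ _

end DoubleRootLifts

/-! ### All three types together: maximal cells, fan, codimension. -/

section DoubleMinimaFan

variable {ι γ : Type*} {cl : ι → γ} {a : ι → ℝ} {i j k l i' j' k' l' : ι}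

theorem tripleMin_congr [DecidableEq ι] (h : ({i, j, k} : Finset ι) = {i', j', k'}) :
    TripleMin i j k a ↔ TripleMin i' j' k' a := by
  have key : ∀ i j k : ι, TripleMin i j k a ↔ ∀ x ∈ ({i, j, k} : Finset ι), ∀ r, a x ≤ a r := by
    intro i j k
    simp only [TripleMin, Finset.forall_mem_insert, Finset.mem_singleton, forall_eq, forall_and]
  rw [key, key, h]

theorem pairMin_congr (hcl : cl i = cl j) (h : s(i, j) = s(i', j')) (h' : s(k, l) = s(k', l')) :
    PairMin cl i j k l a ↔ PairMin cl i' j' k' l' a := by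
  rw [Sym2.eq_iff] at h h'
  rcases h with ⟨rfl, rfl⟩ | ⟨rfl, rfl⟩ <;> rcases h' with ⟨rfl, rfl⟩ | ⟨rfl, rfl⟩ <;>
    simp only [PairMin, hcl, and_comm]

theorem pairMin_or_pairMin_congr (hij : cl i = cl j) (hkl : cl k = cl l)
    (h : s(s(i, j), s(k, l)) = s(s(i', j'), s(k', l'))) :
    (PairMin cl i j k l a ∨ PairMin cl k l i j a) ↔
      (PairMin cl i' j' k' l' a ∨ PairMin cl k' l' i' j' a) := by
  rw [Sym2.eq_iff] at h
  rcases h with ⟨h1, h2⟩ | ⟨h1, h2⟩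
  · rw [pairMin_congr hij h1 h2, pairMin_congr hkl h2 h1]
  · rw [pairMin_congr hij h1 h2, pairMin_congr hkl h2 h1, or_comm]

/-- The pairs of relations that define the cells of all three types. -/
def cellRelations (cl : ι → γ) : Set ((ι → ι → Prop) × (ι → ι → Prop)) :=
  {d | (∃ i j k, ThreeClasses cl i j k ∧ d = (twoEqualities i j i k, tripleIneq i j k)) ∨
    (∃ i j k l, PairAndTwo cl i j k l ∧
      d = (twoEqualities i j k l, pairAndTwoIneq cl i j k l)) ∨
    ∃ i j k l, TwoPairs cl i j k l ∧ d = (twoEqualities i j k l, twoPairsIneq cl i j k l)}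

variable {d d' : (ι → ι → Prop) × (ι → ι → Prop)}

theorem hasDoubleMinima_iff_exists_cellRelations [Finite ι] [Nonempty ι] [Nontrivial γ]
    (hcl : ∀ i j, i ≠ j → ∃ r, cl r ≠ cl i) :
    HasDoubleMinima cl a ↔ ∃ d ∈ cellRelations cl, a ∈ orderCone d.1 d.2 := by
  rw [hasDoubleMinima_iff hcl]
  constructor
  · rintro (⟨i, j, k, h, ha⟩ | ⟨i, j, k, l, h, ha⟩ | ⟨i, j, k, l, h, ha⟩)
    · exact ⟨_, .inl ⟨i, j, k, h, rfl⟩, mem_triple.2 ha⟩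
    · exact ⟨_, .inr (.inl ⟨i, j, k, l, h, rfl⟩), (mem_pairAndTwo h).2 ha⟩
    · exact ⟨_, .inr (.inr ⟨i, j, k, l, h, rfl⟩), (mem_twoPairs h).2 (.inl ha)⟩
  · rintro ⟨d, ⟨i, j, k, h, rfl⟩ | ⟨i, j, k, l, h, rfl⟩ | ⟨i, j, k, l, h, rfl⟩, ha⟩
    · exact .inl ⟨i, j, k, h, mem_triple.1 ha⟩
    · exact .inr (.inl ⟨i, j, k, l, h, (mem_pairAndTwo h).1 ha⟩)
    · rcases (mem_twoPairs h).1 ha with ha | ha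
      · exact .inr (.inr ⟨i, j, k, l, h, ha⟩)
      · refine .inr (.inr ⟨k, l, i, j, ?_, ha⟩)
        unfold TwoPairs at h ⊢
        grind

theorem nonempty_strictOrderCone_of_mem_cellRelations (hd : d ∈ cellRelations cl) :
    (strictOrderCone d.1 d.2).Nonempty := by
  obtain ⟨i, j, k, -, rfl⟩ | ⟨i, j, k, l, h, rfl⟩ | ⟨i, j, k, l, h, rfl⟩ := hd
  exacts [nonempty_triple, nonempty_pairAndTwo h, nonempty_twoPairs h]

theorem PairAndTwo.ne (h : PairAndTwo cl i j k l) : k ≠ l := by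
  rintro rfl
  exact h.2.2.2.2 rfl

theorem PairAndTwo.false_of_mem_twoPairs_strict (h : TwoPairs cl i j k l)
    (ha : a ∈ strictOrderCone (twoEqualities i j k l) (twoPairsIneq cl i j k l))
    (h' : PairAndTwo cl i' j' k' l') (ha' : PairMin cl i' j' k' l' a) : False := by
  have := PairMin.eq_of_mem_twoPairs_strict h ha h'.1 h'.2.1 h'.2.2.1 h'.2.2.2.1 h'.ne ha'
  unfold TwoPairs at h
  unfold PairAndTwo at h'
  simp only [Sym2.eq_iff] at this
  grind

theorem TwoPairs.false_of_mem_pairAndTwo_strict (h : PairAndTwo cl i j k l)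
    (ha : a ∈ strictOrderCone (twoEqualities i j k l) (pairAndTwoIneq cl i j k l))
    (h' : TwoPairs cl i' j' k' l') (ha' : PairMin cl i' j' k' l' a) : False := by
  have := PairMin.eq_of_mem_pairAndTwo_strict h ha h'.1 h'.2.2.1 h'.2.2.2.1 h'.2.2.2.2.1 ha'
  unfold TwoPairs at h'
  unfold PairAndTwo at h
  simp only [Sym2.eq_iff] at this
  grind

theorem TwoPairs.symm (h : TwoPairs cl i j k l) : TwoPairs cl k l i j := by
  unfold TwoPairs at h ⊢
  grind

theorem TwoPairs.eq_of_mem_twoPairs_strict (h : TwoPairs cl i j k l)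
    (ha : a ∈ strictOrderCone (twoEqualities i j k l) (twoPairsIneq cl i j k l))
    (h' : TwoPairs cl i' j' k' l') (ha' : PairMin cl i' j' k' l' a ∨ PairMin cl k' l' i' j' a) :
    s(s(i, j), s(k, l)) = s(s(i', j'), s(k', l')) := by
  rcases ha' with ha' | ha'
  · exact PairMin.eq_of_mem_twoPairs_strict h ha h'.1 h'.2.1 h'.2.2.1 h'.2.2.2.1 h'.2.2.2.2.1 ha'
  · rw [Sym2.eq_swap (a := s(i', j'))]
    obtain ⟨h1, h2, h3, h4, h5, -⟩ := h'.symm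
    exact PairMin.eq_of_mem_twoPairs_strict h ha h1 h2 h3 h4 h5 ha'

theorem orderCone_eq_of_mem_strictOrderCone (hd : d ∈ cellRelations cl)
    (hd' : d' ∈ cellRelations cl) (ha : a ∈ strictOrderCone d.1 d.2)
    (ha' : a ∈ orderCone d'.1 d'.2) : orderCone d.1 d.2 = orderCone d'.1 d'.2 := by
  classical
  obtain ⟨i, j, k, h, rfl⟩ | ⟨i, j, k, l, h, rfl⟩ | ⟨i, j, k, l, h, rfl⟩ := hd <;>
  obtain ⟨i', j', k', h', rfl⟩ | ⟨i', j', k', l', h', rfl⟩ | ⟨i', j', k', l', h', rfl⟩ := hd' <;>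
  dsimp only at ha ha' ⊢
  · have := (mem_triple.1 ha').eq_of_mem_triple_strict ha h'
    ext b
    rw [mem_triple, mem_triple, tripleMin_congr this]
  · exact (((mem_pairAndTwo h').1 ha').false_of_mem_triple_strict h ha h'.1 h'.2.1).elim
  · rcases (mem_twoPairs h').1 ha' with ha' | ha'
    · exact (ha'.false_of_mem_triple_strict h ha h'.1 h'.2.1).elim
    · exact (ha'.false_of_mem_triple_strict h ha h'.symm.1 h'.symm.2.1).elim
  · exact ((mem_triple.1 ha').false_of_mem_pairAndTwo_strict ha h').elim
  · obtain ⟨h1, h2⟩ := ((mem_pairAndTwo h').1 ha').eq_of_mem_pairAndTwo_strict h ha h'.1 h'.2.2.1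
      h'.2.2.2.1 h'.ne
    ext b
    rw [mem_pairAndTwo h, mem_pairAndTwo h', pairMin_congr h.2.1 h1 h2]
  · rcases (mem_twoPairs h').1 ha' with ha' | ha'
    · exact (h'.false_of_mem_pairAndTwo_strict h ha ha').elim
    · exact (h'.symm.false_of_mem_pairAndTwo_strict h ha ha').elim
  · exact ((mem_triple.1 ha').false_of_mem_twoPairs_strict h ha h').elim
  · exact (h'.false_of_mem_twoPairs_strict h ha ((mem_pairAndTwo h').1 ha')).elim
  · have := h.eq_of_mem_twoPairs_strict ha h' ((mem_twoPairs h').1 ha')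
    ext b
    rw [mem_twoPairs h, mem_twoPairs h',
      pairMin_or_pairMin_congr h.2.1 h.2.2.2.2.2 this]

theorem exists_ray_of_mem_cellRelations [Nontrivial γ] (hd : d ∈ cellRelations cl)
    (ha : a ∈ orderCone d.1 d.2) (ha' : a ∉ strictOrderCone d.1 d.2) :
    ∃ e : ι → ℝ, (∀ t : ℝ, 0 < t → a + t • e ∈ orderCone d.1 d.2) ∧
      ∀ t : ℝ, 0 < t → ¬ HasDoubleMinima cl (a - t • e) := by
  obtain ⟨i, j, k, h, rfl⟩ | ⟨i, j, k, l, h, rfl⟩ | ⟨i, j, k, l, h, rfl⟩ := hd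
  · simp only [mem_triple] at ha ⊢
    exact exists_ray_triple ha ha'
  · simp only [mem_pairAndTwo h] at ha ⊢
    exact exists_ray_pairAndTwo h ha ha'
  · exact exists_ray_twoPairs h ha ha'

theorem isMaximalCell_setOf_hasDoubleMinima [Finite ι] [Nonempty ι] [Nontrivial γ]
    (hcl : ∀ i j, i ≠ j → ∃ r, cl r ≠ cl i) :
    {C | IsMaximalCell {a | HasDoubleMinima cl a} C} =
      {C | ∃ d ∈ cellRelations cl, C = orderCone d.1 d.2} := by
  refine setOf_isMaximalCell_eq (fun x => hasDoubleMinima_iff_exists_cellRelations hcl)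
    (fun d hd => nonempty_strictOrderCone_of_mem_cellRelations hd)
    (fun d hd d' hd' x hx hx' => orderCone_eq_of_mem_strictOrderCone hd hd' hx hx')
    fun d hd x hx hx' => ?_
  obtain ⟨e, h1, h2⟩ := exists_ray_of_mem_cellRelations hd hx hx'
  refine ⟨e, fun t ht => (hasDoubleMinima_iff_exists_cellRelations hcl).2 ⟨d, hd, h1 t ht⟩, ?_⟩
  filter_upwards [self_mem_nhdsWithin] with t ht using h2 t ht

theorem cellTransfer_of_mem_openSegment {x y z : ι → ℝ} (hd : d ∈ cellRelations cl)
    (hx : x ∈ orderCone d.1 d.2) (hy : y ∈ orderCone d.1 d.2) (hzd : z ∈ orderCone d.1 d.2)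
    (hz : z ∈ openSegment ℝ x y) : CellTransfer cl z x := by
  have hact : ∀ r s, d.2 r s → z r = z s → x r = x s :=
    fun r s hR h => eq_of_mem_openSegment hx hy hz hR h
  obtain ⟨i, j, k, h, rfl⟩ | ⟨i, j, k, l, h, rfl⟩ | ⟨i, j, k, l, h, rfl⟩ := hd
  · exact cellTransfer_triple h (mem_triple.1 hx) (mem_triple.1 hzd) hact
  · exact cellTransfer_pairAndTwo h ((mem_pairAndTwo h).1 hx) ((mem_pairAndTwo h).1 hzd) hact
  · exact cellTransfer_twoPairs h hx hzd hact

/-- The swap in `CellTransfer` is harmless: for type II it is excluded by `cl k ≠ cl l`, and a type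
III cell contains both orders. -/
theorem CellTransfer.mem_orderCone {x z : ι → ℝ} (h : CellTransfer cl z x)
    (hd : d ∈ cellRelations cl) (hz : z ∈ orderCone d.1 d.2) : x ∈ orderCone d.1 d.2 := by
  obtain ⟨i, j, k, hl, rfl⟩ | ⟨i, j, k, l, hl, rfl⟩ | ⟨i, j, k, l, hl, rfl⟩ := hd
  · exact mem_triple.2 (h.1 i j k hl (mem_triple.1 hz))
  · rcases h.2 i j k l hl.2.1 hl.2.2.1 hl.2.2.2.1 ((mem_pairAndTwo hl).1 hz) with hx | hx
    · exact (mem_pairAndTwo hl).2 hx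
    · exact absurd hx.1 hl.2.2.2.2
  · refine (mem_twoPairs hl).2 ?_
    obtain ⟨-, h2, h3, h4, -⟩ := hl.symm
    rcases (mem_twoPairs hl).1 hz with hz | hz
    · rcases h.2 i j k l hl.2.1 hl.2.2.1 hl.2.2.2.1 hz with hx | hx
      exacts [.inl hx, .inr hx.2]
    · rcases h.2 k l i j h2 h3 h4 hz with hx | hx
      exacts [.inr hx, .inl hx.2]

theorem isFanOfMaximalCones_cellRelations {m : ℕ} [Nonempty (Fin m)] [Nontrivial γ]
    {cl : Fin m → γ} (hcl : ∀ i j, i ≠ j → ∃ r, cl r ≠ cl i) :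
    IsFanOfMaximalCones {a | HasDoubleMinima cl a}
      {C | ∃ d ∈ cellRelations cl, C = orderCone d.1 d.2} where
  finite := by
    have : {C | ∃ d ∈ cellRelations cl, C = orderCone d.1 d.2} =
        (fun d => orderCone d.1 d.2) '' cellRelations cl := by
      ext C
      simp [eq_comm]
    rw [this]
    exact (Set.toFinite _).image _
  cone := by
    rintro _ ⟨d, -, rfl⟩
    exact isRationalCone_orderCone _ _
  faces := by
    rintro _ ⟨d, hd, rfl⟩ _ ⟨d', hd', rfl⟩
    exact ⟨Set.inter_subset_left, fun x hx y hy z hz hzxy => ⟨hx,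
      (cellTransfer_of_mem_openSegment hd hx hy hz.1 hzxy).mem_orderCone hd' hz.2⟩⟩
  maximal := by
    rintro _ ⟨d, hd, rfl⟩ _ ⟨d', hd', rfl⟩ hsub
    obtain ⟨x, hx⟩ := nonempty_strictOrderCone_of_mem_cellRelations hd
    exact orderCone_eq_of_mem_strictOrderCone hd hd' hx (hsub (strictOrderCone_subset_orderCone hx))
  support := by
    ext x
    rw [Set.mem_ofPred_eq, hasDoubleMinima_iff_exists_cellRelations hcl]
    constructor
    · rintro ⟨_, ⟨d, hd, rfl⟩, hx⟩
      exact ⟨d, hd, hx⟩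
    · rintro ⟨d, hd, hx⟩
      exact ⟨_, ⟨d, hd, rfl⟩, hx⟩

theorem finrank_vectorSpan_of_mem_cellRelations [Fintype ι] (hd : d ∈ cellRelations cl) :
    Module.finrank ℝ (vectorSpan ℝ (orderCone d.1 d.2)) + 2 = Module.finrank ℝ (ι → ℝ) := by
  rw [vectorSpan_orderCone (nonempty_strictOrderCone_of_mem_cellRelations hd)]
  obtain ⟨i, j, k, h, rfl⟩ | ⟨i, j, k, l, h, rfl⟩ | ⟨i, j, k, l, h, rfl⟩ := hd
  · unfold ThreeClasses at h
    exact finrank_equalitySubspace (fun _ _ => Iff.rfl) (by grind) (by grind) (by grind) (by grind)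
      (by grind)
  · unfold PairAndTwo at h
    exact finrank_equalitySubspace (fun _ _ => Iff.rfl) (by grind) (by grind) (by grind) (by grind)
      (by grind)
  · unfold TwoPairs at h
    exact finrank_equalitySubspace (fun _ _ => Iff.rfl) (by grind) (by grind) (by grind) (by grind)
      (by grind)

end DoubleMinimaFan

/-! ### Exponent classes modulo `p`, and the identification of `H_{p,n}`. -/

section TropicalDoubleRoots

theorem HasDoubleMinima.comp_monotone {ι γ : Type*} {cl : ι → γ} {a : ι → ℝ}
    (h : HasDoubleMinima cl a) {f : ℝ → ℝ} (hf : Monotone f) :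
    HasDoubleMinima cl fun r => f (a r) := fun c r hr => by
  obtain ⟨s, hs, hsc, hle⟩ := h c r hr
  exact ⟨s, hs, hsc, hf hle⟩

theorem isClosed_setOf_hasDoubleMinima {ι γ : Type*} [Finite ι] (cl : ι → γ) :
    IsClosed {a : ι → ℝ | HasDoubleMinima cl a} := by
  simp only [HasDoubleMinima, Set.ofPred_forall, Set.ofPred_exists]
  refine isClosed_iInter fun c => isClosed_iInter fun r => isClosed_iInter fun _ =>
    isClosed_iUnion_of_finite fun s => ?_
  refine isClosed_const.and (isClosed_const.and ?_)
  exact isClosed_le (continuous_apply s) (continuous_apply r)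

/-- The class of an exponent modulo `p`. -/
def exponentClass (p : ℕ) {n : ℕ} (r : Fin (n + 1)) : ZMod p := ((r : ℕ) : ZMod p)

variable {p n : ℕ}

theorem sameClass_iff {i j : Fin (n + 1)} :
    SameClass p i j ↔ exponentClass p i = exponentClass p j :=
  (ZMod.natCast_eq_natCast_iff _ _ _).symm

theorem labelI_iff {i j k : Fin (n + 1)} :
    LabelI p i j k ↔ ThreeClasses (exponentClass p) i j k := by
  simp only [LabelI, ThreeClasses, sameClass_iff, ne_eq]

theorem labelII_iff {i j k l : Fin (n + 1)} :
    LabelII p i j k l ↔ PairAndTwo (exponentClass p) i j k l := by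
  simp only [LabelII, PairAndTwo, sameClass_iff, ne_eq]

theorem labelIII_iff {i j k l : Fin (n + 1)} :
    LabelIII p i j k l ↔ TwoPairs (exponentClass p) i j k l := by
  simp only [LabelIII, TwoPairs, sameClass_iff, ne_eq]

theorem mem_cellI {i j k : Fin (n + 1)} {a : Fin (n + 1) → ℝ} :
    a ∈ cellI i j k ↔ TripleMin i j k a := by
  simp only [cellI, TripleMin, Set.mem_ofPred_eq, isMinOn_univ_iff, forall_and]

theorem mem_cellII {i j k l : Fin (n + 1)} {a : Fin (n + 1) → ℝ} :
    a ∈ cellII p i j k l ↔ PairMin (exponentClass p) i j k l a := by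
  simp only [cellII, PairMin, Set.mem_ofPred_eq, Set.mem_univ, true_imp_iff, isMinOn_iff, forall_and,
    sameClass_iff, and_assoc, ne_eq]

theorem mem_cellIII {i j k l : Fin (n + 1)} {a : Fin (n + 1) → ℝ} :
    a ∈ cellIII p i j k l ↔
      PairMin (exponentClass p) i j k l a ∨ PairMin (exponentClass p) k l i j a := by
  rw [cellIII, Set.mem_union, mem_cellII, mem_cellII]

theorem orderCone_eq_cellI (i j k : Fin (n + 1)) :
    orderCone (twoEqualities i j i k) (tripleIneq i j k) = cellI i j k :=
  Set.ext fun _ => mem_triple.trans mem_cellI.symm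

theorem orderCone_eq_cellII {i j k l : Fin (n + 1)} (h : LabelII p i j k l) :
    orderCone (twoEqualities i j k l) (pairAndTwoIneq (exponentClass p) i j k l) =
      cellII p i j k l :=
  Set.ext fun _ => (mem_pairAndTwo (labelII_iff.1 h)).trans mem_cellII.symm

theorem orderCone_eq_cellIII {i j k l : Fin (n + 1)} (h : LabelIII p i j k l) :
    orderCone (twoEqualities i j k l) (twoPairsIneq (exponentClass p) i j k l) =
      cellIII p i j k l :=
  Set.ext fun _ => (mem_twoPairs (labelIII_iff.1 h)).trans mem_cellIII.symm

theorem setOf_orderCone_eq_cells (p n : ℕ) :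
    {C | ∃ d ∈ cellRelations (exponentClass p (n := n)), C = orderCone d.1 d.2} =
      cellsI p n ∪ cellsII p n ∪ cellsIII p n := by
  ext C
  constructor
  · rintro ⟨d, ⟨i, j, k, h, rfl⟩ | ⟨i, j, k, l, h, rfl⟩ | ⟨i, j, k, l, h, rfl⟩, rfl⟩
    · exact .inl (.inl ⟨i, j, k, labelI_iff.2 h, orderCone_eq_cellI i j k⟩)
    · exact .inl (.inr ⟨i, j, k, l, labelII_iff.2 h, orderCone_eq_cellII (labelII_iff.2 h)⟩)
    · exact .inr ⟨i, j, k, l, labelIII_iff.2 h, orderCone_eq_cellIII (labelIII_iff.2 h)⟩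
  · rintro ((⟨i, j, k, h, rfl⟩ | ⟨i, j, k, l, h, rfl⟩) | ⟨i, j, k, l, h, rfl⟩)
    · exact ⟨_, .inl ⟨i, j, k, labelI_iff.1 h, rfl⟩, (orderCone_eq_cellI i j k).symm⟩
    · exact ⟨_, .inr (.inl ⟨i, j, k, l, labelII_iff.1 h, rfl⟩), (orderCone_eq_cellII h).symm⟩
    · exact ⟨_, .inr (.inr ⟨i, j, k, l, labelIII_iff.1 h, rfl⟩), (orderCone_eq_cellIII h).symm⟩

theorem exists_exponentClass_ne (hp : p.Prime) (i j : Fin (n + 1)) (hij : i ≠ j) :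
    ∃ r : Fin (n + 1), exponentClass p r ≠ exponentClass p i := by
  have : Fact p.Prime := ⟨hp⟩
  have hn : 1 < n + 1 := by
    by_contra! h
    exact hij (Fin.ext (by omega))
  by_cases h : exponentClass p i = 0
  · refine ⟨⟨1, hn⟩, ?_⟩
    rw [h]
    simp [exponentClass]
  · refine ⟨0, ?_⟩
    simpa [exponentClass] using Ne.symm h

variable {K : Type*} [Field K] [IsAlgClosed K] [CharP K p] {v : AddValuation K (WithTop ℝ)}

/-- The weight `r` in `K` depends only on its class in `𝔽_p`, and differences of distinct classes
are units. This supplies the `M` of the lifting results. -/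
theorem isTropicalDoubleRoot_zero_iff_hasDoubleMinima (hp : p.Prime) {a : Fin (n + 1) → ℝ} :
    IsTropicalDoubleRoot v a 0 ↔
      HasDoubleMinima (exponentClass p) a ∧ ∀ i, ∃ x : K, v x = (a i : WithTop ℝ) := by
  have : Fact p.Prime := ⟨hp⟩
  have hN : ∀ r : Fin (n + 1), ((r : ℕ) : K) = ZMod.castHom dvd_rfl K (exponentClass p r) :=
    fun r => (map_natCast _ _).symm
  have hM : ∀ (r : Fin (n + 1)) (c : ZMod p), exponentClass p r ≠ c →
      v (ZMod.castHom dvd_rfl K (exponentClass p r) - ZMod.castHom dvd_rfl K c) = 0 := by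
    intro r c h
    rw [← map_sub]
    exact AddValuation.map_zmodCast_eq_zero (sub_ne_zero.2 h)
  rw [isTropicalDoubleRoot_zero_iff]
  constructor
  · rintro ⟨A, hA, h1, h2⟩
    exact ⟨hasDoubleMinima_of_sum_eq_zero hA h1 h2 hN hM, fun i => ⟨A i, hA i⟩⟩
  · rintro ⟨h, hT⟩
    choose A hA using hT
    rcases (hasDoubleMinima_iff (exists_exponentClass_ne hp)).1 h with
      ⟨i, j, k, hl, ha⟩ | ⟨i, j, k, l, hl, ha⟩ | ⟨i, j, k, l, hl, ha⟩
    · exact ha.exists_lift p hA hN hM hl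
    · exact ha.exists_lift p hA hN hM hl.1 hl.2.1 hl.2.2.1 hl.2.2.2.1 hl.ne
    · exact ha.exists_lift p hA hN hM hl.1 hl.2.1 hl.2.2.1 hl.2.2.2.1 hl.2.2.2.2.1

theorem tropicalH_eq_setOf_hasDoubleMinima (hp : p.Prime) (hv : ∃ x : K, x ≠ 0 ∧ v x ≠ 0) :
    tropicalH v n = {a | HasDoubleMinima (exponentClass p) a} := by
  apply Set.Subset.antisymm
  · refine closure_minimal (fun a ha => ?_) (isClosed_setOf_hasDoubleMinima _)
    exact ((isTropicalDoubleRoot_zero_iff_hasDoubleMinima hp).1 ha).1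
  · intro a ha
    rw [tropicalH, Metric.mem_closure_iff]
    intro ε hε
    obtain ⟨x, t, hx, ht, htε⟩ := AddValuation.exists_pos_lt hv hε
    -- Rounding down to multiples of `t` is monotone, so it keeps double minima; it lands in the
    -- value group and moves each coordinate by less than `t < ε`.
    have hmono : Monotone fun y : ℝ => (⌊y / t⌋ : ℝ) * t := by
      intro y z hyz
      have : ⌊y / t⌋ ≤ ⌊z / t⌋ := Int.floor_mono (by gcongr)
      have : (⌊y / t⌋ : ℝ) ≤ ⌊z / t⌋ := by exact_mod_cast this
      dsimp only
      gcongr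
    refine ⟨fun r => (⌊a r / t⌋ : ℝ) * t, ?_, ?_⟩
    · exact (isTropicalDoubleRoot_zero_iff_hasDoubleMinima hp).2
        ⟨ha.comp_monotone hmono, fun r => AddValuation.exists_map_eq_intCast_mul hx _⟩
    · rw [dist_pi_lt_iff hε]
      intro r
      have h1 := Int.floor_le (a r / t)
      have h2 := Int.lt_floor_add_one (a r / t)
      rw [le_div_iff₀ ht] at h1
      rw [div_lt_iff₀ ht] at h2
      rw [Real.dist_eq, abs_lt]
      constructor <;> linarith

end TropicalDoubleRoots

/-! ### The theorem, reduced to double minima. -/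

theorem mainTheorem1 (p n : ℕ) (hp : p.Prime) (hp2 : p ≠ 2)
    {K : Type*} [Field K] [IsAlgClosed K] [CharP K p]
    (v : AddValuation K (WithTop ℝ)) (hv : ∃ x : K, x ≠ 0 ∧ v x ≠ 0) :
    -- the maximal cells are exactly those of types I, II and III
    {C | IsMaximalCell (tropicalH v n) C} = cellsI p n ∪ cellsII p n ∪ cellsIII p n ∧
    -- they are the maximal cones of a fan with support `H_{p,n}`
    IsFanOfMaximalCones (tropicalH v n) (cellsI p n ∪ cellsII p n ∪ cellsIII p n) ∧
    -- they all have codimension 2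
    (∀ C ∈ cellsI p n ∪ cellsII p n ∪ cellsIII p n,
      Module.finrank ℝ (vectorSpan ℝ C) + 2 = Module.finrank ℝ (Fin (n + 1) → ℝ)) ∧
    -- no cell is counted twice
    (Disjoint (cellsI p n) (cellsII p n) ∧ Disjoint (cellsI p n) (cellsIII p n) ∧
      Disjoint (cellsII p n) (cellsIII p n)) ∧
    (∀ i j k i' j' k' : Fin (n + 1), LabelI p i j k → LabelI p i' j' k' →
      (cellI i j k = cellI i' j' k' ↔ ({i, j, k} : Finset (Fin (n + 1))) = {i', j', k'})) ∧
    (∀ i j k l i' j' k' l' : Fin (n + 1), LabelII p i j k l → LabelII p i' j' k' l' →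
      (cellII p i j k l = cellII p i' j' k' l' ↔ s(i, j) = s(i', j') ∧ s(k, l) = s(k', l'))) ∧
    (∀ i j k l i' j' k' l' : Fin (n + 1), LabelIII p i j k l → LabelIII p i' j' k' l' →
      (cellIII p i j k l = cellIII p i' j' k' l' ↔
        s(s(i, j), s(k, l)) = s(s(i', j'), s(k', l')))) ∧
    -- taking the closure adds no tropical polynomial with coefficients in the value group
    (∀ a : Fin (n + 1) → ℝ, IsTropicalDoubleRoot v a 0 ↔
      a ∈ tropicalH v n ∧ ∀ i, ∃ x : K, v x = (a i : WithTop ℝ)) := by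
  have : Fact p.Prime := ⟨hp⟩
  have hcl := exists_exponentClass_ne (n := n) hp
  rw [tropicalH_eq_setOf_hasDoubleMinima hp hv, ← setOf_orderCone_eq_cells]
  refine ⟨isMaximalCell_setOf_hasDoubleMinima hcl, isFanOfMaximalCones_cellRelations hcl,
    ?_, ⟨?_, ?_, ?_⟩, ?_, ?_, ?_, fun a => isTropicalDoubleRoot_zero_iff_hasDoubleMinima hp⟩
  · rintro _ ⟨d, hd, rfl⟩
    exact finrank_vectorSpan_of_mem_cellRelations hd
  · rw [Set.disjoint_left]
    rintro _ ⟨i, j, k, h, rfl⟩ ⟨i', j', k', l', h', he⟩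
    -- Here and below, equal cells are compared through a strict point of one of them, which
    -- determines type and label.
    obtain ⟨a, ha⟩ := nonempty_triple (i := i) (j := j) (k := k)
    have ha' : a ∈ cellI i j k := mem_cellI.2 (mem_triple.1 (strictOrderCone_subset_orderCone ha))
    rw [he, mem_cellII] at ha'
    exact ha'.false_of_mem_triple_strict (labelI_iff.1 h) ha h'.1 (sameClass_iff.1 h'.2.1)
  · rw [Set.disjoint_left]
    rintro _ ⟨i, j, k, h, rfl⟩ ⟨i', j', k', l', h', he⟩
    rw [labelI_iff] at h
    rw [labelIII_iff] at h'
    obtain ⟨a, ha⟩ := nonempty_triple (i := i) (j := j) (k := k)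
    have ha' : a ∈ cellI i j k := mem_cellI.2 (mem_triple.1 (strictOrderCone_subset_orderCone ha))
    rw [he, mem_cellIII] at ha'
    rcases ha' with ha' | ha'
    exacts [ha'.false_of_mem_triple_strict h ha h'.1 h'.2.1,
      ha'.false_of_mem_triple_strict h ha h'.symm.1 h'.symm.2.1]
  · rw [Set.disjoint_left]
    rintro _ ⟨i, j, k, l, h, rfl⟩ ⟨i', j', k', l', h', he⟩
    rw [labelII_iff] at h
    rw [labelIII_iff] at h'
    obtain ⟨a, ha⟩ := nonempty_pairAndTwo h
    have ha' : a ∈ cellII p i j k l :=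
      mem_cellII.2 ((mem_pairAndTwo h).1 (strictOrderCone_subset_orderCone ha))
    rw [he, mem_cellIII] at ha'
    rcases ha' with ha' | ha'
    exacts [h'.false_of_mem_pairAndTwo_strict h ha ha',
      h'.symm.false_of_mem_pairAndTwo_strict h ha ha']
  · intro i j k i' j' k' h h'
    refine ⟨fun he => ?_, fun he => Set.ext fun a => by
      rw [mem_cellI, mem_cellI, tripleMin_congr he]⟩
    obtain ⟨a, ha⟩ := nonempty_triple (i := i) (j := j) (k := k)
    have ha' : a ∈ cellI i j k := mem_cellI.2 (mem_triple.1 (strictOrderCone_subset_orderCone ha))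
    rw [he, mem_cellI] at ha'
    exact ha'.eq_of_mem_triple_strict ha (labelI_iff.1 h')
  · intro i j k l i' j' k' l' h h'
    rw [labelII_iff] at h h'
    refine ⟨fun he => ?_, fun he => Set.ext fun a => by
      rw [mem_cellII, mem_cellII, pairMin_congr h.2.1 he.1 he.2]⟩
    obtain ⟨a, ha⟩ := nonempty_pairAndTwo h
    have ha' : a ∈ cellII p i j k l :=
      mem_cellII.2 ((mem_pairAndTwo h).1 (strictOrderCone_subset_orderCone ha))
    rw [he, mem_cellII] at ha'
    exact ha'.eq_of_mem_pairAndTwo_strict h ha h'.1 h'.2.2.1 h'.2.2.2.1 h'.ne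
  · intro i j k l i' j' k' l' h h'
    rw [labelIII_iff] at h h'
    refine ⟨fun he => ?_, fun he => Set.ext fun a => by
      rw [mem_cellIII, mem_cellIII, pairMin_or_pairMin_congr h.2.1 h.2.2.2.2.2 he]⟩
    obtain ⟨a, ha⟩ := nonempty_twoPairs h
    have ha' : a ∈ cellIII p i j k l :=
      mem_cellIII.2 ((mem_twoPairs h).1 (strictOrderCone_subset_orderCone ha))
    rw [he, mem_cellIII] at ha'
    exact h.eq_of_mem_twoPairs_strict ha h' ha'
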